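/- Let $1<\gamma<\frac{\sqrt7+1}{\sqrt7-1}$, let $R>0$, and fix a state $(\rho_-,u_-,e_-)$ with $\rho_->0$, $e_->0$. Write $P=(\gamma-1)\rho e$ for the pressure and $c=\sqrt{\gamma(\gamma-1)e}$ for the sound speed. A state $(\rho_+,u_+,e_+)$ with $\rho_+,e_+>0$ and a speed $\sigma$ form, together with $(\rho_-,u_-,e_-)$, a $1$-shock of the Euler equations if, with $v_\pm=u_\pm-\sigma$, the quantities $\rho v$, $\rho v^2+P$ and $\rho v(e+v^2/2)+Pv$ take the same values $j$, $jC_1$, $jC_2$ at both states, and $u_+-c_+<\sigma<u_+$, $\sigma<u_--c_-$. Its strength is $a=|u_+-u_-|/2$, and to it one associates the polynomial function $$f(x)=\frac{4(\gamma-1)}{jR^4(\gamma+1)}\Big(\frac{C_1}{\gamma+1}-x\Big)^3\Big(x+\frac{\gamma C_1}{\gamma+1}\Big)^3\Big(2x+\frac{(\gamma-1)C_1}{\gamma+1}\Big).$$ Then there is a nonincreasing sequence of positive numbers $(a_n)_{n\in\mathbb N}$, depending only on $(\rho_-,u_-,e_-)$, $\gamma$ and $R$, such that for every $n\ge 0$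 and every such $1$-shock with strength $a\in(0,a_n]$ the following holds. (i) $f(0)^2-2a^2>0$ and $w_0:=\frac12\big(-f(0)+\sqrt{f(0)^2-2a^2}\big)<0$. The system $$V'=VW,\qquad W'=-W^2-f(V)W+\frac{V^2-a^2}{2}$$ has a solution $(V_\flat,W_\flat)$ on $\mathbb R$ that tends to $(a,0)$ at $-\infty$ and to $(0,w_0)$ at $+\infty$, with $V_\flat$ strictly decreasing and converging to $0$ exponentially at $+\infty$, and a solution $(V_\sharp,W_\sharp)$ on $\mathbb R$ that tends to $(-a,0)$ at $-\infty$ and to $(0,w_0)$ at $+\infty$, with $V_\sharp$ strictly increasing and converging to $0$ exponentially at $+\infty$. (ii) For all such solutions, $\Xi_\flat(\eta)=-\int_\eta^{+\infty}V_\flat(\zeta)\,d\zeta$ and $\Xi_\sharp(\eta)=-\int_\eta^{+\infty}V_\sharp(\zeta)\,d\zeta$ are bijections from $\mathbb R$ onto $(-\infty,0)$ and $(0,+\infty)$ respectively. The glued functions, defined by $(\hat v,w)=(V_\flat,W_\flat)\circ\Xi_\flat^{-1}$ on $(-\infty,0)$, $(\hat v,w)=(V_\sharp,W_\sharp)\circ\Xi_\sharp^{-1}$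 on $(0,+\infty)$ and $(\hat v,w)(0)=(0,w_0)$, satisfy on all of $\mathbb R$ $$\hat v'=w,\qquad \hat v\,w'=-w^2-f(\hat v)\,w+\frac{\hat v^2-a^2}{2},$$ with $\hat v\in(-a,a)$, $(\hat v,w)\to(a,0)$ at $-\infty$ and $(\hat v,w)\to(-a,0)$ at $+\infty$. Moreover $w\in C^{n+1}(\mathbb R)$, $\hat v\in C^{n+2}(\mathbb R)$, and $$w(\xi)=w_0+w_1\hat v(\xi)+\cdots+w_{n+1}\hat v(\xi)^{n+1}+o\big(\hat v(\xi)^{n+1}\big)\qquad(\xi\to0).$$ Here $$w_k=\frac{b_{k-1}}{f(0)+(k+2)w_0}\quad(1\le k\le n+1),$$ the denominators being nonzero, and $$b_0=-f'(0)w_0,\qquad b_1=\tfrac12-2w_1^2-f'(0)w_1-\tfrac{f''(0)}2w_0\quad(\text{if } n\ge1),$$ $$b_k=-\sum_{i=1}^{k+1}\frac{f^{(i)}(0)}{i!}\,w_{k+1-i}-\sum_{i=1}^{k}(i+1)\,w_i\,w_{k+1-i}\quad(2\le k\le n).$$ -/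

import Mathlib

namespace RadShock

open Set Filter Topology

noncomputable section

/-- Density, velocity and specific internal energy of the gas. -/
structure GasState where
  ρ : ℝ
  u : ℝ
  e : ℝ

/-- Physical states: positive density and positive internal energy. -/
def GasState.Admissible (s : GasState) : Prop := 0 < s.ρ ∧ 0 < s.e

/-- Pressure of a perfect gas. -/
def GasState.pressure (γ : ℝ) (s : GasState) : ℝ := (γ - 1) * s.ρ * s.e

/-- Sound speed of a perfect gas. -/
def GasState.sound (γ : ℝ) (s : GasState) : ℝ := Real.sqrt (γ * (γ - 1) * s.e)

/-- Mass flux `j` of the state `s` in the frame moving at speed `σ`. -/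
def massFlux (σ : ℝ) (s : GasState) : ℝ := s.ρ * (s.u - σ)

/-- Momentum flux in the frame moving at speed `σ`. -/
def momentumFlux (γ σ : ℝ) (s : GasState) : ℝ := s.ρ * (s.u - σ) ^ 2 + s.pressure γ

/-- Energy flux in the frame moving at speed `σ`. -/
def energyFlux (γ σ : ℝ) (s : GasState) : ℝ :=
  s.ρ * (s.u - σ) * (s.e + (s.u - σ) ^ 2 / 2) + s.pressure γ * (s.u - σ)

/-- `(sm, sp)` is a Lax `1`-shock of speed `σ` for the Euler equations: the Rankine-Hugoniot
conditions and the Lax inequalities for the first characteristic family. -/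
structure IsOneShock (γ : ℝ) (sm sp : GasState) (σ : ℝ) : Prop where
  mass : massFlux σ sp = massFlux σ sm
  momentum : momentumFlux γ σ sp = momentumFlux γ σ sm
  energy : energyFlux γ σ sp = energyFlux γ σ sm
  lax_right_lower : sp.u - sp.sound γ < σ
  lax_right_upper : σ < sp.u
  lax_left : σ < sm.u - sm.sound γ

/-- The constant `C₁`: momentum flux divided by mass flux. -/
def C₁ (γ σ : ℝ) (s : GasState) : ℝ := momentumFlux γ σ s / massFlux σ s

/-- Strength of the shock. -/
def strength (sm sp : GasState) : ℝ := |sp.u - sm.u| / 2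

/-- The polynomial function `f` of the travelling wave system, in terms of the constants
`γ`, `R` (perfect gas constant), `j` and `C₁`. -/
def fPoly (γ R j c : ℝ) (x : ℝ) : ℝ :=
  4 * (γ - 1) / (j * R ^ 4 * (γ + 1)) * (c / (γ + 1) - x) ^ 3 *
    (x + γ * c / (γ + 1)) ^ 3 * (2 * x + (γ - 1) * c / (γ + 1))

/-- The function `f` attached to a shock of speed `σ` with left state `sm`. -/
def shockF (γ R σ : ℝ) (sm : GasState) : ℝ → ℝ :=
  fPoly γ R (massFlux σ sm) (C₁ γ σ sm)

/-- The number `w₀`. -/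
def wZero (f : ℝ → ℝ) (a : ℝ) : ℝ := (-f 0 + Real.sqrt (f 0 ^ 2 - 2 * a ^ 2)) / 2

/-- `(V, W)` is a solution, on the whole line, of the desingularized system. -/
def SolvesReg (f : ℝ → ℝ) (a : ℝ) (V W : ℝ → ℝ) : Prop :=
  ∀ η : ℝ, HasDerivAt V (V η * W η) η ∧
    HasDerivAt W (-W η ^ 2 - f (V η) * W η + (V η ^ 2 - a ^ 2) / 2) η

/-- Exponential convergence to `0` at `+∞`. -/
def ExpDecay (V : ℝ → ℝ) : Prop :=
  ∃ C c : ℝ, 0 < c ∧ ∀ η : ℝ, 0 ≤ η → |V η| ≤ C * Real.exp (-c * η)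

/-- The orbit from `(a, 0)` to `(0, w₀)`, with decreasing first component. -/
structure IsFlat (f : ℝ → ℝ) (a : ℝ) (V W : ℝ → ℝ) : Prop where
  solves : SolvesReg f a V W
  V_atBot : Tendsto V atBot (𝓝 a)
  W_atBot : Tendsto W atBot (𝓝 0)
  V_atTop : Tendsto V atTop (𝓝 0)
  W_atTop : Tendsto W atTop (𝓝 (wZero f a))
  anti : StrictAnti V
  decay : ExpDecay V

/-- The orbit from `(-a, 0)` to `(0, w₀)`, with increasing first component. -/
structure IsSharp (f : ℝ → ℝ) (a : ℝ) (V W : ℝ → ℝ) : Prop where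
  solves : SolvesReg f a V W
  V_atBot : Tendsto V atBot (𝓝 (-a))
  W_atBot : Tendsto W atBot (𝓝 0)
  V_atTop : Tendsto V atTop (𝓝 0)
  W_atTop : Tendsto W atTop (𝓝 (wZero f a))
  mono : StrictMono V
  decay : ExpDecay V

/-- The change of variable `Ξ(η) = -∫_η^{+∞} V(ζ) dζ`. -/
def Xi (V : ℝ → ℝ) (η : ℝ) : ℝ := -∫ ζ in Ioi η, V ζ

/-- `G₁ ∘ Ξ₁⁻¹` for `ξ < 0`, `G₂ ∘ Ξ₂⁻¹` for `ξ > 0`, and the value `z` at `ξ = 0`, where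
`Ξ₁, Ξ₂` are the changes of variable attached to `V₁, V₂`. -/
def glue (V₁ V₂ G₁ G₂ : ℝ → ℝ) (z : ℝ) (ξ : ℝ) : ℝ :=
  if ξ < 0 then G₁ (Function.invFun (Xi V₁) ξ)
  else if 0 < ξ then G₂ (Function.invFun (Xi V₂) ξ)
  else z

/-- `(v, w)` solves, on the whole line, the (singular) travelling wave system, connects `(a, 0)`
to `(-a, 0)`, and `v` takes its values in `(-a, a)`. -/
structure IsProfile (f : ℝ → ℝ) (a : ℝ) (v w : ℝ → ℝ) : Prop where
  hasDeriv_v : ∀ ξ : ℝ, HasDerivAt v (w ξ) ξ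
  differentiable_w : Differentiable ℝ w
  eq_w : ∀ ξ : ℝ, v ξ * deriv w ξ = -w ξ ^ 2 - f (v ξ) * w ξ + (v ξ ^ 2 - a ^ 2) / 2
  v_atBot : Tendsto v atBot (𝓝 a)
  w_atBot : Tendsto w atBot (𝓝 0)
  v_atTop : Tendsto v atTop (𝓝 (-a))
  w_atTop : Tendsto w atTop (𝓝 0)
  mem : ∀ ξ : ℝ, v ξ ∈ Ioo (-a) a

/-- The recursive formulas for `w₀, …, w_{n+1}` and `b₀, …, b_n`. They determine these numbers;
the divisions are by nonzero numbers. -/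
structure IsCoeffs (f : ℝ → ℝ) (a : ℝ) (n : ℕ) (w b : ℕ → ℝ) : Prop where
  w_zero : w 0 = wZero f a
  denom_ne : ∀ k ∈ Finset.Icc 1 (n + 1), f 0 + ((k : ℝ) + 2) * w 0 ≠ 0
  w_eq : ∀ k ∈ Finset.Icc 1 (n + 1), w k = b (k - 1) / (f 0 + ((k : ℝ) + 2) * w 0)
  b_zero : b 0 = -deriv f 0 * w 0
  b_one : 1 ≤ n →
    b 1 = 1 / 2 - 2 * w 1 ^ 2 - deriv f 0 * w 1 - iteratedDeriv 2 f 0 / 2 * w 0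
  b_eq : ∀ k ∈ Finset.Icc 2 n,
    b k = -(∑ i ∈ Finset.Icc 1 (k + 1), iteratedDeriv i f 0 / (i.factorial : ℝ) * w (k + 1 - i))
      - (∑ i ∈ Finset.Icc 1 k, ((i : ℝ) + 1) * w i * w (k + 1 - i))

end

end RadShock

open Set Filter Topology RadShock

open Set Filter Topology RadShock

/-! The substitution dξ = V dη sends the sonic point ξ = 0 to η = +∞, so the profile is assembled
from two orbits of the regular system.

Existence. An orbit leaving (a, 0) is sought as W = -(a - V) k. In a parameter s along which V is
the logistic curve, k obeys a scalar nonautonomous equation. If f ≥ 2a on [0, a], this equation is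
contracting on a strip κ ≤ k ≤ 1/2 and points inward at its edges, so a fixed point argument gives a
solution on the whole line (`exists_bounded_solution`, `exists_slope`). The time η is recovered from
S' = k(S). Reflection V ↦ -V gives the other orbit.

Regularity. At the sonic point v has a simple zero, with slope w₀ < 0. The derivatives of w and the
remainder of its expansion all solve linear equations φ y' = α y + β with φ = v. When α / φ' > 0 at
the zero, every solution tends to -β / α there, whichever side it comes from
(`tendsto_of_singular`). Each differentiation lowers α / φ' by one (`contDiff_of_singular`). For w'
the ratio is -(f(0) + 3 w₀) / w₀, so f(0) + (n + 3) w₀ > 0 is what class C^{n+1} requires; the same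
inequality makes the denominators of the w_k positive and controls the remainder.

Smallness. Since w₀ ≥ -a/2, everything follows from (n + 3) a ≤ f(0) and f ≥ 2a on [-a, a]. For weak
shocks with a given left state, j is bounded above and C₁ below, so f ≥ m > 0 on some [-δ, δ]
uniformly (`exists_uniform_lower_bound`), and a_n = min(δ, m / (n + 3)) works. -/

namespace RadShock

/-! ### Linear equations with a singular point: limits and regularity -/

/-- A scalar linear equation with uniformly damping coefficient and vanishing forcing: every
solution tends to `0`. -/
theorem tendsto_zero_of_damped {z α ε : ℝ → ℝ} {m : ℝ} (hm : 0 < m)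
    (hz : ∀ᶠ t in atTop, HasDerivAt z (-α t * z t + ε t) t)
    (hα : ∀ᶠ t in atTop, m ≤ α t) (hε : Tendsto ε atTop (𝓝 0)) :
    Tendsto z atTop (𝓝 0) := by
  have key : ∀ s > 0, ∀ᶠ t in atTop, |z t| < s := by
    intro s hs
    have hs2 : 0 < s / 2 := by positivity
    have hε' : ∀ᶠ t in atTop, |ε t| < m * (s / 2) := by
      have := hε.abs
      rw [abs_zero] at this
      exact this.eventually_lt_const (by positivity)
    obtain ⟨T, hT⟩ := eventually_atTop.1 (hz.and (hα.and hε'))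
    -- By Young's inequality, (z²)' ≤ -m z² + ε² / m ≤ -m (z² - (s/2)²), so q is nonincreasing and
    -- z² - (s/2)² is at most a multiple of e^{-mt}.
    let q : ℝ → ℝ := fun t => (z t ^ 2 - (s / 2) ^ 2) * Real.exp (m * t)
    have hq : ∀ t, T ≤ t → HasDerivAt q
        ((2 * z t * (-α t * z t + ε t)) * Real.exp (m * t)
          + (z t ^ 2 - (s / 2) ^ 2) * (Real.exp (m * t) * m)) t := by
      intro t ht
      have h1 := ((hT t ht).1.pow 2).sub_const ((s / 2) ^ 2)
      have h2 : HasDerivAt (fun t => Real.exp (m * t)) (Real.exp (m * t) * m) t := by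
        simpa using ((hasDerivAt_id t).const_mul m).exp
      exact (h1.mul h2).congr_deriv (by norm_num)
    have hanti : AntitoneOn q (Ici T) := by
      apply antitoneOn_of_deriv_nonpos (convex_Ici T)
      · exact fun t ht => (hq t ht).continuousAt.continuousWithinAt
      · intro t ht
        rw [interior_Ici] at ht
        exact (hq t ht.le).differentiableAt.differentiableWithinAt
      · intro t ht
        rw [interior_Ici] at ht
        rw [(hq t ht.le).deriv]
        obtain ⟨-, ha, he⟩ := hT t ht.le
        have he2 : ε t ^ 2 ≤ (m * (s / 2)) ^ 2 := by
          rw [← sq_abs]; gcongr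
        have hle : 2 * z t * (-α t * z t + ε t) + (z t ^ 2 - (s / 2) ^ 2) * m ≤ 0 := by
          have h1 : (α t - m) * z t ^ 2 ≥ 0 := mul_nonneg (by linarith) (sq_nonneg _)
          have h2 : 2 * z t * ε t ≤ m * z t ^ 2 + ε t ^ 2 / m := by
            have : 0 ≤ (m * z t - ε t) ^ 2 / m := by positivity
            have h3 : (m * z t - ε t) ^ 2 / m = m * z t ^ 2 - 2 * z t * ε t + ε t ^ 2 / m := by
              field_simp
              ring
            linarith
          have h3 : ε t ^ 2 / m ≤ m * (s / 2) ^ 2 := by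
            rw [div_le_iff₀ hm]; linarith
          nlinarith
        have := Real.exp_pos (m * t)
        nlinarith
    have hlim : Tendsto (fun t => (s / 2) ^ 2 + q T * Real.exp (-(m * t))) atTop
        (𝓝 ((s / 2) ^ 2 + q T * 0)) := by
      refine tendsto_const_nhds.add (tendsto_const_nhds.mul ?_)
      exact Real.tendsto_exp_neg_atTop_nhds_zero.comp (tendsto_id.const_mul_atTop hm)
    have hev := hlim.eventually_lt_const (show (s / 2) ^ 2 + q T * 0 < s ^ 2 by nlinarith)
    filter_upwards [hev, eventually_ge_atTop T] with t ht1 ht2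
    have h := hanti self_mem_Ici ht2 ht2
    have hz2 : z t ^ 2 - (s / 2) ^ 2 ≤ q T * Real.exp (-(m * t)) := by
      rw [Real.exp_neg, ← div_eq_mul_inv, le_div_iff₀ (Real.exp_pos _)]
      exact h
    exact abs_lt_of_sq_lt_sq (by linarith) hs.le
  rw [Metric.tendsto_atTop']
  intro s hs
  obtain ⟨T, hT⟩ := eventually_atTop.1 (key s hs)
  exact ⟨T, fun t ht => by simpa using hT t ht.le⟩

/-- With x = e^{-t} the equation becomes a damped one on a half-line: x / φ(x) → 1 / ω, so the
damping coefficient tends to α₀ / ω > 0. Subtracting L = -β₀ / α₀ makes the forcing vanish in the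
limit. -/
theorem tendsto_right_of_singular {y φ α β : ℝ → ℝ} {ω α₀ β₀ : ℝ}
    (hφ : HasDerivAt φ ω 0) (hφ0 : φ 0 = 0) (hω : ω ≠ 0)
    (hy : ∀ᶠ x in 𝓝[>] 0, HasDerivAt y ((α x * y x + β x) / φ x) x)
    (hα : Tendsto α (𝓝[>] 0) (𝓝 α₀)) (hβ : Tendsto β (𝓝[>] 0) (𝓝 β₀)) (hpos : 0 < α₀ / ω) :
    Tendsto y (𝓝[>] 0) (𝓝 (-β₀ / α₀)) := by
  have hα₀ : α₀ ≠ 0 := by rintro rfl; simp at hpos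
  set L := -β₀ / α₀ with hL
  have hratio : Tendsto (fun x => x / φ x) (𝓝[>] 0) (𝓝 ω⁻¹) := by
    have h := hasDerivAt_iff_tendsto_slope.1 hφ
    have h' := (h.mono_left (nhdsWithin_mono 0 (fun x (hx : 0 < x) => hx.ne'))).inv₀ hω
    refine h'.congr fun x => ?_
    simp [slope_def_field, hφ0]
  have hexp : Tendsto (fun t : ℝ => Real.exp (-t)) atTop (𝓝[>] 0) :=
    tendsto_nhdsWithin_iff.2 ⟨Real.tendsto_exp_neg_atTop_nhds_zero,
      Eventually.of_forall fun t => Real.exp_pos _⟩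
  have hA : Tendsto (fun t : ℝ => Real.exp (-t) / φ (Real.exp (-t)) * α (Real.exp (-t))) atTop
      (𝓝 (α₀ / ω)) := by
    have := (hratio.mul hα).comp hexp
    rw [div_eq_inv_mul]
    exact this
  have hE : Tendsto (fun t : ℝ => -(Real.exp (-t) / φ (Real.exp (-t)) *
      (α (Real.exp (-t)) * L + β (Real.exp (-t))))) atTop (𝓝 0) := by
    have := (hratio.mul ((hα.mul_const L).add hβ)).neg.comp hexp
    have h0 : α₀ * L + β₀ = 0 := by rw [hL]; field_simp; ring
    rw [h0, mul_zero, neg_zero] at this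
    exact this
  have hz := tendsto_zero_of_damped (z := fun t => y (Real.exp (-t)) - L) (half_pos hpos)
    (α := fun t => Real.exp (-t) / φ (Real.exp (-t)) * α (Real.exp (-t)))
    (ε := fun t : ℝ => -(Real.exp (-t) / φ (Real.exp (-t)) *
      (α (Real.exp (-t)) * L + β (Real.exp (-t))))) ?_ ?_ hE
  · have hlog : Tendsto (fun x : ℝ => -Real.log x) (𝓝[>] 0) atTop :=
      tendsto_neg_atBot_atTop.comp Real.tendsto_log_nhdsGT_zero
    have h := (hz.comp hlog).add_const L
    rw [zero_add] at h
    refine h.congr' ?_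
    filter_upwards [self_mem_nhdsWithin] with x hx
    simp [Real.exp_log hx]
  · filter_upwards [hexp.eventually hy] with t ht
    have he : HasDerivAt (fun t : ℝ => Real.exp (-t)) (Real.exp (-t) * (-1)) t :=
      (hasDerivAt_neg t).exp
    have := (ht.comp t he).sub_const L
    refine this.congr_deriv ?_
    ring
  · filter_upwards [hA.eventually_const_lt (half_lt_self hpos)] with t ht using ht.le

/-- Solutions of `φ y' = α y + β` near a simple zero of `φ` with `α / φ' > 0` there have a limit. -/
theorem tendsto_of_singular {y φ α β : ℝ → ℝ} {ω α₀ β₀ : ℝ}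
    (hφ : HasDerivAt φ ω 0) (hφ0 : φ 0 = 0) (hω : ω ≠ 0)
    (hy : ∀ᶠ x in 𝓝[≠] 0, HasDerivAt y ((α x * y x + β x) / φ x) x)
    (hα : Tendsto α (𝓝[≠] 0) (𝓝 α₀)) (hβ : Tendsto β (𝓝[≠] 0) (𝓝 β₀)) (hpos : 0 < α₀ / ω) :
    Tendsto y (𝓝[≠] 0) (𝓝 (-β₀ / α₀)) := by
  have hgt : 𝓝[>] (0 : ℝ) ≤ 𝓝[≠] 0 := nhdsWithin_mono 0 (fun x (hx : 0 < x) => hx.ne')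
  have hlt : 𝓝[<] (0 : ℝ) ≤ 𝓝[≠] 0 := nhdsWithin_mono 0 (fun x (hx : x < 0) => hx.ne)
  have hneg : Tendsto (fun x : ℝ => -x) (𝓝[>] 0) (𝓝[<] 0) := by
    simpa using tendsto_neg_nhdsGT (a := (0 : ℝ))
  have hneg' : Tendsto (fun x : ℝ => -x) (𝓝[<] 0) (𝓝[>] 0) := by
    simpa using tendsto_neg_nhdsLT (a := (0 : ℝ))
  rw [← Iio_union_Ioi, nhdsWithin_union, tendsto_sup]
  constructor
  · have h := tendsto_right_of_singular (y := fun x => y (-x)) (φ := fun x => -φ (-x))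
      (α := fun x => α (-x)) (β := fun x => β (-x)) (ω := ω) (α₀ := α₀) (β₀ := β₀)
      ?_ (by simp [hφ0]) hω ?_ ((hα.mono_left hlt).comp hneg) ((hβ.mono_left hlt).comp hneg) hpos
    · refine (h.comp hneg').congr fun x => by simp
    · have h0 : HasDerivAt φ ω (-0) := by simpa using hφ
      refine ((h0.comp 0 (hasDerivAt_neg 0)).neg).congr_deriv (by ring)
    · filter_upwards [hneg.eventually (hy.filter_mono hlt)] with x hx
      refine (hx.comp x (hasDerivAt_neg x)).congr_deriv ?_
      rw [div_neg]; ring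
  · exact tendsto_right_of_singular hφ hφ0 hω (hy.filter_mono hgt) (hα.mono_left hgt)
      (hβ.mono_left hgt) hpos

/-- Solutions of `φ y' = α y + β` across a simple zero of `φ` with `α / φ' > k` there are of
class `C^k`. -/
theorem contDiff_of_singular {φ : ℝ → ℝ} (hφ0 : φ 0 = 0) (hφne : ∀ x ≠ 0, φ x ≠ 0)
    (hω : deriv φ 0 ≠ 0) (k : ℕ) :
    ∀ {y α β : ℝ → ℝ}, ContDiff ℝ ((k + 1 : ℕ) : WithTop ℕ∞) φ → ContDiff ℝ (k : WithTop ℕ∞) α →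
      ContDiff ℝ (k : WithTop ℕ∞) β → (k : ℝ) < α 0 / deriv φ 0 →
      (∀ x ≠ 0, HasDerivAt y ((α x * y x + β x) / φ x) x) → y 0 = -β 0 / α 0 →
      ContDiff ℝ (k : WithTop ℕ∞) y := by
  induction k with
  | zero =>
    intro y α β hφ hα hβ hk hy hy0
    have hφ' : HasDerivAt φ (deriv φ 0) 0 := (hφ.differentiable (by simp) 0).hasDerivAt
    rw [Nat.cast_zero, contDiff_zero] at hα hβ ⊢
    rw [continuous_iff_continuousAt]
    intro x
    by_cases hx : x = 0
    · subst hx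
      rw [← continuousWithinAt_compl_self, ContinuousWithinAt, hy0]
      exact tendsto_of_singular hφ' hφ0 hω (eventually_mem_nhdsWithin.mono fun x hx => hy x hx)
        hα.continuousAt.continuousWithinAt hβ.continuousAt.continuousWithinAt (by simpa using hk)
    · exact (hy x hx).continuousAt
  | succ k ih =>
    intro y α β hφ hα hβ hk hy hy0
    push_cast at hk
    have hk0 : (0 : ℝ) ≤ k := k.cast_nonneg
    have hyk : ContDiff ℝ (k : WithTop ℕ∞) y :=
      ih (hφ.of_le (by gcongr; omega)) (hα.of_le (by gcongr; omega))
        (hβ.of_le (by gcongr; omega)) (by linarith) hy hy0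
    have hsucc : ((k + 1 : ℕ) : WithTop ℕ∞) = (k : WithTop ℕ∞) + 1 := by push_cast; rfl
    have hφs : ((k + 1 + 1 : ℕ) : WithTop ℕ∞) = ((k + 1 : ℕ) : WithTop ℕ∞) + 1 := by push_cast; rfl
    have hφ' : ContDiff ℝ ((k + 1 : ℕ) : WithTop ℕ∞) (deriv φ) := by
      rw [hφs, contDiff_succ_iff_deriv] at hφ
      exact hφ.2.2
    have hα' : ContDiff ℝ (k : WithTop ℕ∞) (deriv α) := by
      rw [hsucc, contDiff_succ_iff_deriv] at hα
      exact hα.2.2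
    have hβ' : ContDiff ℝ (k : WithTop ℕ∞) (deriv β) := by
      rw [hsucc, contDiff_succ_iff_deriv] at hβ
      exact hβ.2.2
    have dφ : ∀ x, HasDerivAt φ (deriv φ x) x := fun x =>
      (hφ.differentiable (by simp) x).hasDerivAt
    have dα : ∀ x, HasDerivAt α (deriv α x) x := fun x =>
      (hα.differentiable (by simp) x).hasDerivAt
    have dβ : ∀ x, HasDerivAt β (deriv β x) x := fun x =>
      (hβ.differentiable (by simp) x).hasDerivAt
    -- Differentiating φ y' = α y + β gives φ d' = (α - φ') d + α' y + β' for d = y', an equation of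
    -- the same type whose ratio at 0 is α / φ' - 1. The value of d at 0 is the only one compatible
    -- with continuity; once d is continuous, it is the derivative of y at 0 too.
    let α₁ : ℝ → ℝ := fun x => α x - deriv φ x
    let β₁ : ℝ → ℝ := fun x => deriv α x * y x + deriv β x
    let d : ℝ → ℝ := fun x => if x = 0 then -β₁ 0 / α₁ 0 else (α x * y x + β x) / φ x
    have hd0 : d 0 = -β₁ 0 / α₁ 0 := if_pos rfl
    have hdne : ∀ x ≠ 0, d x = (α x * y x + β x) / φ x := fun x hx => if_neg hx
    have hd : ContDiff ℝ (k : WithTop ℕ∞) d := by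
      refine ih (α := α₁) (β := β₁) (hφ.of_le (by gcongr; omega))
        ((hα.of_le (by gcongr; omega)).sub (hφ'.of_le (by gcongr; omega)))
        ((hα'.mul hyk).add hβ') ?_ ?_ hd0
      · show (k : ℝ) < (α 0 - deriv φ 0) / deriv φ 0
        rw [sub_div, div_self hω]
        linarith
      · intro x hx
        have hev : d =ᶠ[𝓝 x] fun x => (α x * y x + β x) / φ x :=
          eventually_of_mem (isOpen_ne.mem_nhds hx) hdne
        have h := (((dα x).mul (hy x hx)).add (dβ x)).div (dφ x) (hφne x hx)
        refine (h.congr_of_eventuallyEq hev).congr_deriv ?_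
        rw [hdne x hx]
        have := hφne x hx
        simp only [α₁, β₁, Pi.add_apply, Pi.mul_apply]
        field_simp
        ring
    have hy' : ∀ x, HasDerivAt y (d x) x := by
      refine fun x => hasDerivAt_of_hasDerivAt_of_ne' (x := 0) (fun x hx => ?_) ?_ ?_ x
      · rw [hdne x hx]; exact hy x hx
      · exact hyk.continuous.continuousAt
      · exact hd.continuous.continuousAt
    rw [hsucc, contDiff_succ_iff_deriv]
    refine ⟨fun x => (hy' x).differentiableAt, by simp, ?_⟩
    rwa [show deriv y = d from funext fun x => (hy' x).deriv]

/-- Smoothness through the sonic point of solutions of the singular travelling wave system. -/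
theorem contDiff_of_singular_system {f v w : ℝ → ℝ} {a : ℝ} (hf : ContDiff ℝ (⊤ : ℕ∞) f)
    (hv0 : v 0 = 0) (hvne : ∀ x ≠ 0, v x ≠ 0) (hv : ∀ x, HasDerivAt v (w x) x)
    (hw : ∀ x ≠ 0, HasDerivAt w ((-w x ^ 2 - f (v x) * w x + (v x ^ 2 - a ^ 2) / 2) / v x) x)
    (hwc : ContinuousAt w 0) (hw0 : w 0 < 0) (n : ℕ) (hn : 0 < f 0 + (n + 3) * w 0) :
    ContDiff ℝ ((n + 1 : ℕ) : WithTop ℕ∞) w := by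
  have hderiv_v : deriv v = w := funext fun x => (hv x).deriv
  have hv_succ : ∀ k : ℕ, ContDiff ℝ (k : WithTop ℕ∞) w →
      ContDiff ℝ ((k + 1 : ℕ) : WithTop ℕ∞) v := by
    intro k hk
    rw [show ((k + 1 : ℕ) : WithTop ℕ∞) = (k : WithTop ℕ∞) + 1 by push_cast; rfl,
      contDiff_succ_iff_deriv]
    exact ⟨fun x => (hv x).differentiableAt, by simp, by rwa [hderiv_v]⟩
  have hf' : ContDiff ℝ (⊤ : ℕ∞) (deriv f) := by
    have : ContDiff ℝ ((⊤ : ℕ∞) + 1 : WithTop ℕ∞) f := by simpa using hf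
    exact (contDiff_succ_iff_deriv.1 this).2.2
  have main : ∀ k ≤ n + 1, ContDiff ℝ (k : WithTop ℕ∞) w := by
    intro k
    induction k with
    | zero =>
      intro _
      rw [Nat.cast_zero, contDiff_zero, continuous_iff_continuousAt]
      intro x
      by_cases hx : x = 0
      · exact hx ▸ hwc
      · exact (hw x hx).continuousAt
    | succ k ih =>
      intro hk
      have hwk := ih (by omega)
      have hvk := hv_succ k hwk
      have hvk' : ContDiff ℝ (k : WithTop ℕ∞) v := hvk.of_le (by gcongr; omega)
      have hle : (k : WithTop ℕ∞) ≤ ((⊤ : ℕ∞) : WithTop ℕ∞) := by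
        exact_mod_cast (le_top : ((k : ℕ∞) ≤ ⊤))
      -- Differentiating v w' = -w² - f(v) w + (v² - a²)/2 gives a linear equation v d' = α d + β
      -- for d = w'. As w(0) < 0, the condition k < α(0) / w(0) reads f(0) + (k + 3) w(0) > 0.
      let α : ℝ → ℝ := fun x => -3 * w x - f (v x)
      let β : ℝ → ℝ := fun x => v x * w x - deriv f (v x) * w x ^ 2
      let d : ℝ → ℝ := fun x => if x = 0 then -β 0 / α 0 else
        (-w x ^ 2 - f (v x) * w x + (v x ^ 2 - a ^ 2) / 2) / v x
      have hdne : ∀ x ≠ 0, d x = (-w x ^ 2 - f (v x) * w x + (v x ^ 2 - a ^ 2) / 2) / v x :=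
        fun x hx => if_neg hx
      have hd : ContDiff ℝ (k : WithTop ℕ∞) d := by
        refine contDiff_of_singular (α := α) (β := β) hv0 hvne (by rw [hderiv_v]; exact hw0.ne)
          k hvk ?_ ?_ ?_ ?_ (if_pos rfl)
        · exact (contDiff_const.mul hwk).sub ((hf.of_le hle).comp hvk')
        · exact (hvk'.mul hwk).sub (((hf'.of_le hle).comp hvk').mul (hwk.pow 2))
        · rw [hderiv_v]
          show (k : ℝ) < (-3 * w 0 - f (v 0)) / w 0
          rw [hv0, lt_div_iff_of_neg hw0]
          have : (k : ℝ) ≤ n := by exact_mod_cast (by omega : k ≤ n)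
          nlinarith
        · intro x hx
          have hev : d =ᶠ[𝓝 x] fun x =>
              (-w x ^ 2 - f (v x) * w x + (v x ^ 2 - a ^ 2) / 2) / v x :=
            eventually_of_mem (isOpen_ne.mem_nhds hx) hdne
          have hfv : HasDerivAt (fun x => f (v x)) (deriv f (v x) * w x) x :=
            ((hf.differentiable (by simp) (v x)).hasDerivAt).comp x (hv x)
          have h := (((((hw x hx).pow 2).neg.sub (hfv.mul (hw x hx))).add
            ((((hv x).pow 2).sub_const (a ^ 2)).div_const 2))).div (hv x) (hvne x hx)
          refine (h.congr_of_eventuallyEq hev).congr_deriv ?_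
          rw [hdne x hx]
          have := hvne x hx
          simp only [α, β, Pi.add_apply, Pi.mul_apply, Pi.sub_apply, Pi.neg_apply, Pi.pow_apply]
          field_simp
          ring
      have hw' : ∀ x, HasDerivAt w (d x) x := by
        refine fun x => hasDerivAt_of_hasDerivAt_of_ne' (x := 0) (fun x hx => ?_) hwc ?_ x
        · rw [hdne x hx]; exact hw x hx
        · exact hd.continuous.continuousAt
      rw [show ((k + 1 : ℕ) : WithTop ℕ∞) = (k : WithTop ℕ∞) + 1 by push_cast; rfl,
        contDiff_succ_iff_deriv]
      refine ⟨fun x => (hw' x).differentiableAt, by simp, ?_⟩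
      rwa [show deriv w = d from funext fun x => (hw' x).deriv]
  exact main (n + 1) le_rfl

/-! ### Bounded solutions on the whole line of scalar equations -/

/-- The bounded solution of `y' = h - Λ y`. -/
noncomputable def expAverage (Λ : ℝ) (h : ℝ → ℝ) (s : ℝ) : ℝ :=
  Real.exp (-(Λ * s)) * ∫ r in Iic s, Real.exp (Λ * r) * h r

theorem integrableOn_exp_mul_of_bounded {Λ : ℝ} (hΛ : 0 < Λ) {h : ℝ → ℝ} (hc : Continuous h)
    {C : ℝ} (hC : ∀ s, |h s| ≤ C) (s : ℝ) :
    MeasureTheory.IntegrableOn (fun r => Real.exp (Λ * r) * h r) (Iic s) := by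
  refine MeasureTheory.Integrable.mul_bdd (c := C) (integrableOn_exp_mul_Iic hΛ s)
    hc.aestronglyMeasurable (Eventually.of_forall hC)

theorem hasDerivAt_expAverage {Λ : ℝ} (hΛ : 0 < Λ) {h : ℝ → ℝ} (hc : Continuous h)
    {C : ℝ} (hC : ∀ s, |h s| ≤ C) (s : ℝ) :
    HasDerivAt (expAverage Λ h) (h s - Λ * expAverage Λ h s) s := by
  have hcont : Continuous fun r => Real.exp (Λ * r) * h r := by fun_prop
  have hint := integrableOn_exp_mul_of_bounded hΛ hc hC
  have h1 : HasDerivAt (fun s => ∫ r in Iic s, Real.exp (Λ * r) * h r)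
      (Real.exp (Λ * s) * h s) s := by
    have hF := (intervalIntegral.integral_hasDerivAt_right (hcont.intervalIntegrable 0 s)
      (hcont.stronglyMeasurableAtFilter _ _) hcont.continuousAt).const_add
      (∫ r in Iic 0, Real.exp (Λ * r) * h r)
    refine hF.congr_of_eventuallyEq (Eventually.of_forall fun x => ?_)
    have := intervalIntegral.integral_Iic_sub_Iic (hint 0) (hint x)
    simp only
    linarith
  have h2 : HasDerivAt (fun s => Real.exp (-(Λ * s))) (Real.exp (-(Λ * s)) * (-Λ)) s := by
    simpa using ((hasDerivAt_id s).const_mul Λ).neg.exp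
  refine (h2.mul h1).congr_deriv ?_
  have : Real.exp (-(Λ * s)) * Real.exp (Λ * s) = 1 := by rw [← Real.exp_add]; simp
  unfold expAverage
  linear_combination h s * this

/-- The kernel e^{-Λ(s - r)} on r ≤ s has mass 1 / Λ, so a constant forcing Λ b averages to b. -/
theorem expAverage_le {Λ : ℝ} (hΛ : 0 < Λ) {h : ℝ → ℝ} (hc : Continuous h)
    {C : ℝ} (hC : ∀ s, |h s| ≤ C) {b : ℝ} (hb : ∀ s, h s ≤ Λ * b) (s : ℝ) :
    expAverage Λ h s ≤ b := by
  have h1 : ∫ r in Iic s, Real.exp (Λ * r) * h r ≤ ∫ r in Iic s, Real.exp (Λ * r) * (Λ * b) := by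
    refine MeasureTheory.integral_mono (integrableOn_exp_mul_of_bounded hΛ hc hC s)
      ((integrableOn_exp_mul_Iic hΛ s).mul_const _) fun r => ?_
    exact mul_le_mul_of_nonneg_left (hb r) (Real.exp_pos _).le
  rw [MeasureTheory.integral_mul_const, integral_exp_mul_Iic hΛ] at h1
  have h2 := mul_le_mul_of_nonneg_left h1 (Real.exp_pos (-(Λ * s))).le
  have h3 : Real.exp (-(Λ * s)) * Real.exp (Λ * s) = 1 := by rw [← Real.exp_add]; simp
  calc expAverage Λ h s ≤ Real.exp (-(Λ * s)) * (Real.exp (Λ * s) / Λ * (Λ * b)) := h2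
    _ = (Real.exp (-(Λ * s)) * Real.exp (Λ * s)) * b := by field_simp
    _ = b := by rw [h3, one_mul]

theorem expAverage_neg (Λ : ℝ) (h : ℝ → ℝ) (s : ℝ) :
    expAverage Λ (fun r => -h r) s = -expAverage Λ h s := by
  simp [expAverage, MeasureTheory.integral_neg]

theorem le_expAverage {Λ : ℝ} (hΛ : 0 < Λ) {h : ℝ → ℝ} (hc : Continuous h)
    {C : ℝ} (hC : ∀ s, |h s| ≤ C) {b : ℝ} (hb : ∀ s, Λ * b ≤ h s) (s : ℝ) :
    b ≤ expAverage Λ h s := by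
  have := expAverage_le hΛ (h := fun r => -h r) hc.neg (C := C) (by simpa using hC) (b := -b)
    (fun s => by have := hb s; simp only [mul_neg]; linarith) s
  rw [expAverage_neg] at this
  linarith

theorem expAverage_sub {Λ : ℝ} (hΛ : 0 < Λ) {h₁ h₂ : ℝ → ℝ} (hc₁ : Continuous h₁)
    (hc₂ : Continuous h₂) {C : ℝ} (hC₁ : ∀ s, |h₁ s| ≤ C) (hC₂ : ∀ s, |h₂ s| ≤ C) (s : ℝ) :
    expAverage Λ (fun r => h₁ r - h₂ r) s = expAverage Λ h₁ s - expAverage Λ h₂ s := by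
  simp only [expAverage, mul_sub]
  rw [MeasureTheory.integral_sub (integrableOn_exp_mul_of_bounded hΛ hc₁ hC₁ s)
    (integrableOn_exp_mul_of_bounded hΛ hc₂ hC₂ s), mul_sub]

/-- A contracting nonautonomous scalar equation `k' = G(s, k) - Λ k` pointing inward at the ends of
`[lo, hi]` has a solution on the whole line with values in `[lo, hi]`. -/
theorem exists_bounded_solution {G : ℝ → ℝ → ℝ} {lo hi Λ q : ℝ} (hlohi : lo ≤ hi) (hΛ : 0 < Λ)
    (hq0 : 0 ≤ q) (hq : q < Λ)
    (hG : ∀ k : ℝ → ℝ, Continuous k → (∀ s, k s ∈ Icc lo hi) → Continuous fun s => G s (k s))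
    (hLip : ∀ s, ∀ k ∈ Icc lo hi, ∀ k' ∈ Icc lo hi, |G s k - G s k'| ≤ q * |k - k'|)
    (hmem : ∀ s, ∀ k ∈ Icc lo hi, G s k ∈ Icc (Λ * lo) (Λ * hi)) :
    ∃ k : ℝ → ℝ, (∀ s, k s ∈ Icc lo hi) ∧ ∀ s, HasDerivAt k (G s (k s) - Λ * k s) s := by
  -- Clamping to [lo, hi] lets the integral operator act on all bounded continuous functions. Its
  -- values lie in [lo, hi], so the clamp is inactive at the fixed point.
  let c : ℝ → ℝ := fun x => max lo (min hi x)
  have hcc : Continuous c := by fun_prop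
  have hcmem : ∀ x, c x ∈ Icc lo hi := fun x =>
    ⟨le_max_left _ _, max_le hlohi (min_le_left _ _)⟩
  have hcid : ∀ x ∈ Icc lo hi, c x = x := fun x hx => by
    simp only [c]; rw [min_eq_right hx.2, max_eq_right hx.1]
  have hcdist : ∀ x y, |c x - c y| ≤ |x - y| := fun x y => by
    simp only [c]
    refine (abs_max_sub_max_le_max _ _ _ _).trans ?_
    rw [sub_self, abs_zero]
    refine max_le (abs_nonneg _) ((abs_min_sub_min_le_max _ _ _ _).trans ?_)
    rw [sub_self, abs_zero]
    exact max_le (abs_nonneg _) le_rfl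
  let H : (BoundedContinuousFunction ℝ ℝ) → ℝ → ℝ := fun k s => G s (c (k s))
  have hHc : ∀ k, Continuous (H k) := fun k =>
    hG _ (hcc.comp k.continuous) fun s => hcmem _
  have hHmem : ∀ k s, H k s ∈ Icc (Λ * lo) (Λ * hi) := fun k s => hmem s _ (hcmem _)
  set C := max |Λ * lo| |Λ * hi| with hCdef
  have hHC : ∀ k s, |H k s| ≤ C := fun k s => abs_le_max_abs_abs (hHmem k s).1 (hHmem k s).2
  have hlow : ∀ k s, lo ≤ expAverage Λ (H k) s := fun k s =>
    le_expAverage hΛ (hHc k) (hHC k) (fun s => (hHmem k s).1) s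
  have hup : ∀ k s, expAverage Λ (H k) s ≤ hi := fun k s =>
    expAverage_le hΛ (hHc k) (hHC k) (fun s => (hHmem k s).2) s
  have hTc : ∀ k, Continuous (expAverage Λ (H k)) := fun k =>
    continuous_iff_continuousAt.2 fun s =>
      (hasDerivAt_expAverage hΛ (hHc k) (hHC k) s).continuousAt
  let T : BoundedContinuousFunction ℝ ℝ → BoundedContinuousFunction ℝ ℝ := fun k =>
    BoundedContinuousFunction.ofNormedAddCommGroup (expAverage Λ (H k)) (hTc k) (max |lo| |hi|)
      fun s => abs_le_max_abs_abs (hlow k s) (hup k s)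
  have hT : ContractingWith (Real.toNNReal (q / Λ)) T := by
    refine ⟨?_, LipschitzWith.of_dist_le_mul fun k k' => ?_⟩
    · rw [Real.toNNReal_lt_one]
      exact (div_lt_one hΛ).2 hq
    · rw [Real.coe_toNNReal _ (by positivity), BoundedContinuousFunction.dist_le (by positivity)]
      intro s
      show |expAverage Λ (H k) s - expAverage Λ (H k') s| ≤ q / Λ * dist k k'
      rw [← expAverage_sub hΛ (hHc k) (hHc k') (hHC k) (hHC k')]
      have hd : ∀ r, |H k r - H k' r| ≤ Λ * (q / Λ * dist k k') := fun r => by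
        have h1 := hLip r _ (hcmem (k r)) _ (hcmem (k' r))
        have h2 := hcdist (k r) (k' r)
        have h3 : |k r - k' r| ≤ dist k k' := by
          rw [← Real.dist_eq]
          exact BoundedContinuousFunction.dist_coe_le_dist r
        calc |H k r - H k' r| ≤ q * |c (k r) - c (k' r)| := h1
          _ ≤ q * dist k k' := by gcongr; exact h2.trans h3
          _ = _ := by field_simp
      have hcd : Continuous fun r => H k r - H k' r := (hHc k).sub (hHc k')
      rw [abs_le]
      refine ⟨le_expAverage hΛ hcd hd (fun r => ?_) s,
        expAverage_le hΛ hcd hd (fun r => (abs_le.1 (hd r)).2) s⟩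
      rw [mul_neg]
      exact (abs_le.1 (hd r)).1
  obtain ⟨k, hk⟩ : ∃ k, T k = k := ⟨_, hT.fixedPoint_isFixedPt⟩
  have hk' : ∀ s, expAverage Λ (H k) s = k s := fun s => congrArg (fun g => g s) hk
  have hkmem : ∀ s, k s ∈ Icc lo hi := fun s => by
    rw [← hk']; exact ⟨hlow k s, hup k s⟩
  refine ⟨k, hkmem, fun s => ?_⟩
  have h := hasDerivAt_expAverage hΛ (hHc k) (hHC k) s
  rw [show expAverage Λ (H k) = k from funext hk'] at h
  simpa only [H, hcid _ (hkmem s)] using h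

/-- Global solvability of the autonomous scalar equation `S' = k(S)` for a continuous `k` bounded
between two positive constants. -/
theorem exists_autonomous_solution {k : ℝ → ℝ} (hk : Continuous k) {κ K : ℝ} (hκ : 0 < κ)
    (hkm : ∀ s, k s ∈ Icc κ K) :
    ∃ S : ℝ → ℝ, (∀ η, HasDerivAt S (k (S η)) η) ∧ StrictMono S ∧ Tendsto S atTop atTop ∧
      Tendsto S atBot atBot ∧ ∀ η, 0 ≤ η → κ * η ≤ S η := by
  have hpos : ∀ s, 0 < k s := fun s => hκ.trans_le (hkm s).1
  have hK : 0 < K := (hpos 0).trans_le (hkm 0).2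
  have hkinv : Continuous fun s => (k s)⁻¹ := hk.inv₀ fun s => (hpos s).ne'
  -- Separation of variables: τ is the time needed to reach s, and S is its inverse. The bounds on k
  -- make τ' lie in [1/K, 1/κ].
  let τ : ℝ → ℝ := fun s => ∫ r in (0 : ℝ)..s, (k r)⁻¹
  have hτ : ∀ s, HasDerivAt τ (k s)⁻¹ s := fun s =>
    intervalIntegral.integral_hasDerivAt_right (hkinv.intervalIntegrable 0 s)
      (hkinv.stronglyMeasurableAtFilter _ _) hkinv.continuousAt
  have hτd : Differentiable ℝ τ := fun s => (hτ s).differentiableAt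
  have hτmono : StrictMono τ := strictMono_of_deriv_pos fun s => by
    rw [(hτ s).deriv]; exact inv_pos.2 (hpos s)
  have hτ0 : τ 0 = 0 := intervalIntegral.integral_same
  have hτlow : ∀ s t, s ≤ t → K⁻¹ * (t - s) ≤ τ t - τ s := fun s t hst =>
    mul_sub_le_image_sub_of_le_deriv hτd (fun x => by
      rw [(hτ x).deriv]; exact inv_anti₀ (hpos x) (hkm x).2) hst
  have hτup : ∀ s t, s ≤ t → τ t - τ s ≤ κ⁻¹ * (t - s) := fun s t hst =>
    image_sub_le_mul_sub_of_deriv_le hτd (fun x => by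
      rw [(hτ x).deriv]; exact inv_anti₀ hκ (hkm x).1) hst
  have htop : Tendsto τ atTop atTop := by
    refine tendsto_atTop_mono' _ ?_ (tendsto_id.const_mul_atTop (inv_pos.2 hK))
    filter_upwards [eventually_ge_atTop 0] with s hs
    simpa [hτ0] using hτlow 0 s hs
  have hbot : Tendsto τ atBot atBot := by
    refine tendsto_atBot_mono' _ ?_ (tendsto_id.const_mul_atBot (inv_pos.2 hK))
    filter_upwards [eventually_le_atBot 0] with s hs
    have := hτlow s 0 hs
    simp only [id]
    linarith
  have hsurj : Function.Surjective τ := hτd.continuous.surjective htop hbot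
  let e : ℝ ≃o ℝ := hτmono.orderIsoOfSurjective τ hsurj
  have he : ∀ η, τ (e.symm η) = η := fun η => e.apply_symm_apply η
  refine ⟨e.symm, fun η => ?_, e.symm.strictMono, e.symm.tendsto_atTop, e.symm.tendsto_atBot,
    fun η hη => ?_⟩
  · have := HasDerivAt.of_local_left_inverse (f := τ) (g := e.symm)
      e.symm.continuous.continuousAt (hτ (e.symm η)) (inv_ne_zero (hpos _).ne')
      (Eventually.of_forall he)
    simpa using this
  · have h0 : e.symm 0 = 0 := by
      apply hτmono.injective
      rw [he, hτ0]
    have h1 : 0 ≤ e.symm η := by rw [← h0]; exact e.symm.monotone hη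
    have h2 := hτup 0 _ h1
    rw [he, hτ0, sub_zero, sub_zero] at h2
    calc κ * η ≤ κ * (κ⁻¹ * e.symm η) := by gcongr
      _ = e.symm η := by field_simp

/-! ### The rest point (0, w₀) and the two orbits reaching it -/

theorem wZero_quadratic {f : ℝ → ℝ} {a : ℝ} (h : 0 ≤ f 0 ^ 2 - 2 * a ^ 2) :
    wZero f a ^ 2 + f 0 * wZero f a + a ^ 2 / 2 = 0 := by
  have := Real.sq_sqrt h
  unfold wZero
  linear_combination this / 4

theorem disc_pos {f : ℝ → ℝ} {a : ℝ} (ha : 0 < a) (hfa : 2 * a ≤ f 0) :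
    0 < f 0 ^ 2 - 2 * a ^ 2 := by
  nlinarith

theorem wZero_neg {f : ℝ → ℝ} {a : ℝ} (ha : 0 < a) (hfa : 2 * a ≤ f 0) : wZero f a < 0 := by
  have h : Real.sqrt (f 0 ^ 2 - 2 * a ^ 2) < f 0 := by
    rw [Real.sqrt_lt' (by linarith)]
    nlinarith
  unfold wZero
  linarith

/-- The inequality (f(0) - a)² ≤ f(0)² - 2a² amounts to 3a ≤ 2 f(0). This bound turns smallness of a
into positivity of f(0) + (n + 3) w₀. -/
theorem neg_half_le_wZero {f : ℝ → ℝ} {a : ℝ} (ha : 0 < a) (hfa : 2 * a ≤ f 0) :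
    -(a / 2) ≤ wZero f a := by
  have h : f 0 - a ≤ Real.sqrt (f 0 ^ 2 - 2 * a ^ 2) := Real.le_sqrt_of_sq_le (by nlinarith)
  unfold wZero
  linarith

/-- The logistic profile, decreasing from `a` to `0`. -/
noncomputable def logistic (a s : ℝ) : ℝ := a / (1 + Real.exp (a * s))

theorem logistic_pos {a : ℝ} (ha : 0 < a) (s : ℝ) : 0 < logistic a s :=
  div_pos ha (by positivity)

theorem logistic_lt {a : ℝ} (ha : 0 < a) (s : ℝ) : logistic a s < a :=
  div_lt_self ha (by have := Real.exp_pos (a * s); linarith)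

theorem hasDerivAt_logistic (a s : ℝ) :
    HasDerivAt (logistic a) (-(logistic a s * (a - logistic a s))) s := by
  have he : HasDerivAt (fun s => 1 + Real.exp (a * s)) (Real.exp (a * s) * a) s := by
    simpa using (((hasDerivAt_id s).const_mul a).exp).const_add 1
  have hne : 1 + Real.exp (a * s) ≠ 0 := by positivity
  refine ((hasDerivAt_const s a).div he hne).congr_deriv ?_
  simp only [logistic]
  field_simp
  ring

theorem logistic_le_exp {a : ℝ} (ha : 0 < a) (s : ℝ) :
    logistic a s ≤ a * Real.exp (-(a * s)) := by
  rw [Real.exp_neg, ← div_eq_mul_inv]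
  exact div_le_div_of_nonneg_left ha.le (Real.exp_pos _) (by linarith)

theorem tendsto_logistic_atTop {a : ℝ} (ha : 0 < a) : Tendsto (logistic a) atTop (𝓝 0) := by
  have h : Tendsto (fun s => 1 + Real.exp (a * s)) atTop atTop :=
    tendsto_atTop_add_const_left _ _
      (Real.tendsto_exp_atTop.comp (tendsto_id.const_mul_atTop ha))
  exact h.const_div_atTop a

theorem tendsto_logistic_atBot {a : ℝ} (ha : 0 < a) : Tendsto (logistic a) atBot (𝓝 a) := by
  have h : Tendsto (fun s => a / (1 + Real.exp (a * s))) atBot (𝓝 (a / (1 + 0))) :=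
    tendsto_const_nhds.div (tendsto_const_nhds.add
      (Real.tendsto_exp_atBot.comp (tendsto_id.const_mul_atBot ha))) (by norm_num)
  rw [add_zero, div_one] at h
  exact h

theorem strictAnti_logistic {a : ℝ} (ha : 0 < a) : StrictAnti (logistic a) :=
  strictAnti_of_deriv_neg fun s => by
    rw [(hasDerivAt_logistic a s).deriv, neg_lt_zero]
    exact mul_pos (logistic_pos ha s) (sub_pos.2 (logistic_lt ha s))

/-- The slope equation along the logistic profile: a solution bounded away from `0`. -/
theorem exists_slope {f : ℝ → ℝ} {a : ℝ} (hf : Continuous f) (ha : 0 < a)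
    (hfa : ∀ x ∈ Icc 0 a, 2 * a ≤ f x) :
    ∃ κ > 0, ∃ k : ℝ → ℝ, (∀ s, k s ∈ Icc κ (1 / 2)) ∧ ∀ s, HasDerivAt k
      ((a - 2 * logistic a s) * k s - f (logistic a s) + (a + logistic a s) / (2 * k s)) s := by
  obtain ⟨M, hM⟩ := (isCompact_Icc.bddAbove_image (hf.continuousOn (s := Icc 0 a)))
  have hM' : ∀ x ∈ Icc 0 a, f x ≤ M := fun x hx => hM ⟨x, hx, rfl⟩
  have hMpos : 2 * a ≤ M := (hfa 0 ⟨le_rfl, ha.le⟩).trans (hM' 0 ⟨le_rfl, ha.le⟩)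
  have hM0 : 0 < M := by linarith
  -- Chosen so that at k = κ the singular term (a + v) / (2κ) is at least a / (2κ) = 2M, which beats
  -- f ≤ M.
  set κ : ℝ := a / (4 * M) with hκdef
  have hκ : 0 < κ := by positivity
  have hκM : a = 4 * M * κ := by rw [hκdef]; field_simp
  have hκ8 : κ ≤ 1 / 8 := by
    rw [hκdef, div_le_div_iff₀ (by positivity) (by norm_num)]
    linarith
  have hv : ∀ s, logistic a s ∈ Icc 0 a := fun s =>
    ⟨(logistic_pos ha s).le, (logistic_lt ha s).le⟩
  -- On the strip k k' ≤ 1/4, so the difference quotients of the slope field in k are at most a - 2v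
  -- - 2(a + v) ≤ -a. Adding Λ k, with Λ large enough to make G nondecreasing in k, leaves the
  -- Lipschitz constant Λ - a < Λ.
  let Λ : ℝ := a + a / κ ^ 2
  have hΛa : a < Λ := lt_add_of_pos_right _ (by positivity)
  have hΛ : 0 < Λ := ha.trans hΛa
  have hcontl : Continuous (logistic a) :=
    continuous_iff_continuousAt.2 fun s => (hasDerivAt_logistic a s).continuousAt
  let G : ℝ → ℝ → ℝ := fun s k =>
    (a - 2 * logistic a s) * k - f (logistic a s) + (a + logistic a s) / (2 * k) + Λ * k
  let B : ℝ → ℝ → ℝ → ℝ := fun s k k' =>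
    (a - 2 * logistic a s) - (a + logistic a s) / (2 * (k * k')) + Λ
  have hGB : ∀ s k k', 0 < k → 0 < k' → G s k - G s k' = B s k k' * (k - k') := by
    intro s k k' hk hk'
    simp only [G, B]
    field_simp
    ring
  have hB : ∀ s, ∀ k ∈ Icc κ (1 / 2), ∀ k' ∈ Icc κ (1 / 2), B s k k' ∈ Icc 0 (Λ - a) := by
    intro s k hk k' hk'
    have hkp : 0 < k := hκ.trans_le hk.1
    have hkp' : 0 < k' := hκ.trans_le hk'.1
    have hprod : k * k' ≤ 1 / 4 := by
      calc k * k' ≤ 1 / 2 * (1 / 2) := mul_le_mul hk.2 hk'.2 hkp'.le (by norm_num)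
        _ = 1 / 4 := by norm_num
    have hprod' : κ ^ 2 ≤ k * k' := by
      rw [sq]; exact mul_le_mul hk.1 hk'.1 hκ.le hkp.le
    have hpp : 0 < k * k' := mul_pos hkp hkp'
    obtain ⟨h0, h1⟩ := hv s
    have hl : 2 * (a + logistic a s) ≤ (a + logistic a s) / (2 * (k * k')) := by
      rw [le_div_iff₀ (by positivity)]
      nlinarith
    have hu : (a + logistic a s) / (2 * (k * k')) ≤ a / κ ^ 2 := by
      rw [div_le_div_iff₀ (by positivity) (by positivity)]
      have : (a + logistic a s) * κ ^ 2 ≤ (2 * a) * (k * k') :=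
        mul_le_mul (by linarith) hprod' (by positivity) (by linarith)
      linarith
    simp only [B, Λ, mem_Icc]
    constructor <;> linarith
  have hhalf : (1 / 2 : ℝ) ∈ Icc κ (1 / 2) := ⟨by linarith, le_rfl⟩
  have hκmem : κ ∈ Icc κ (1 / 2) := ⟨le_rfl, by linarith⟩
  suffices h : ∃ k : ℝ → ℝ, (∀ s, k s ∈ Icc κ (1 / 2)) ∧
      ∀ s, HasDerivAt k (G s (k s) - Λ * k s) s by
    obtain ⟨k, hk, hk'⟩ := h
    refine ⟨κ, hκ, k, hk, fun s => (hk' s).congr_deriv ?_⟩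
    simp only [G]
    ring
  refine exists_bounded_solution (q := Λ - a) (by linarith) hΛ (by linarith) (by linarith)
    ?_ ?_ ?_
  · intro k hk hkm
    have hne : ∀ s, 2 * k s ≠ 0 := fun s => by
      have := hκ.trans_le (hkm s).1
      positivity
    simp only [G]
    exact ((((continuous_const.sub (continuous_const.mul hcontl)).mul hk).sub
      (hf.comp hcontl)).add ((continuous_const.add hcontl).div (continuous_const.mul hk) hne)).add
      (continuous_const.mul hk)
  · intro s k hk k' hk'
    rw [hGB s k k' (hκ.trans_le hk.1) (hκ.trans_le hk'.1), abs_mul]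
    gcongr
    have := hB s k hk k' hk'
    rw [abs_of_nonneg this.1]
    exact this.2
  · intro s k hk
    have hkp : 0 < k := hκ.trans_le hk.1
    have hb1 := (hB s k hk _ hhalf).1
    have hb2 := (hB s k hk _ hκmem).1
    have e1 := hGB s k (1 / 2) hkp (by norm_num)
    have e2 := hGB s k κ hkp hκ
    have m1 : B s k (1 / 2) * (k - 1 / 2) ≤ 0 :=
      mul_nonpos_of_nonneg_of_nonpos hb1 (by linarith [hk.2])
    have m2 : 0 ≤ B s k κ * (k - κ) := mul_nonneg hb2 (by linarith [hk.1])
    obtain ⟨h0, h1⟩ := hv s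
    have hfl := hfa _ (hv s)
    have hfu := hM' _ (hv s)
    constructor
    -- G is monotone in k, so the ends of the strip suffice. At κ the slope field is at least -aκ -
    -- M + 2M ≥ 0.
    · have hG : Λ * κ ≤ G s κ := by
        have h3 : 2 * M ≤ (a + logistic a s) / (2 * κ) := by
          rw [le_div_iff₀ (by positivity)]
          linarith
        have h4 : -a * κ ≤ (a - 2 * logistic a s) * κ := by
          apply mul_le_mul_of_nonneg_right _ hκ.le
          linarith
        have h5 : a * κ ≤ M := by nlinarith
        simp only [G]
        linarith
      linarith
    -- At 1/2 the slope field is exactly 3a/2 - f, negative because f ≥ 2a.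
    · have hG : G s (1 / 2) ≤ Λ * (1 / 2) := by
        simp only [G]
        norm_num
        linarith
      linarith

/-- Take V = v(S) and W = -(a - v(S)) k(S), with v the logistic curve. Since v' = -v (a - v), the
equation V' = V W amounts to S' = k(S), and the W-equation becomes the slope equation. Boundedness
of k forces W → 0 at -∞; the lower bound κ gives the exponential decay. -/
theorem exists_isFlat {f : ℝ → ℝ} {a : ℝ} (hf : Continuous f) (ha : 0 < a)
    (hfa : ∀ x ∈ Icc 0 a, 2 * a ≤ f x) : ∃ V W : ℝ → ℝ, IsFlat f a V W := by
  obtain ⟨κ, hκ, k, hkm, hk⟩ := exists_slope hf ha hfa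
  have hf0 := hfa 0 ⟨le_rfl, ha.le⟩
  have hkpos : ∀ s, 0 < k s := fun s => hκ.trans_le (hkm s).1
  have hkc : Continuous k := continuous_iff_continuousAt.2 fun s => (hk s).continuousAt
  obtain ⟨S, hS, hSmono, hStop, hSbot, hSlow⟩ := exists_autonomous_solution hkc hκ hkm
  have hw0 := wZero_neg ha hf0
  have hquad := wZero_quadratic (disc_pos ha hf0).le
  -- the limit of the slope
  have hklim : Tendsto k atTop (𝓝 (-wZero f a / a)) := by
    set l := -wZero f a / a with hl
    have hl0 : 0 < l := div_pos (by linarith) ha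
    have hl2 : l ≤ 1 / 2 := by
      rw [hl, div_le_iff₀ ha]
      linarith [neg_half_le_wZero ha hf0]
    have hwl : wZero f a = -(a * l) := by rw [hl]; field_simp
    have hε : Tendsto (fun s => (a - 2 * logistic a s) * l - f (logistic a s)
        + (a + logistic a s) / (2 * l)) atTop (𝓝 0) := by
      have hcont : Continuous fun x : ℝ => (a - 2 * x) * l - f x + (a + x) / (2 * l) := by
        fun_prop
      have h := (hcont.tendsto 0).comp (tendsto_logistic_atTop ha)
      have h0 : (a - 2 * 0) * l - f 0 + (a + 0) / (2 * l) = 0 := by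
        rw [hwl] at hquad
        have : a * ((a * l - f 0) * (2 * l) + a) = 0 := by linear_combination 2 * hquad
        have := (mul_eq_zero.1 this).resolve_left ha.ne'
        field_simp
        linear_combination this
      rw [h0] at h
      exact h
    -- The number l is a zero of the limiting slope field at v = 0. Since k and l are at most 1/2,
    -- the difference k - l is damped at rate at least a.
    have hz := tendsto_zero_of_damped (z := fun s => k s - l) (m := a) ha
      (α := fun s => (a + logistic a s) / (2 * (k s * l)) - (a - 2 * logistic a s))
      (Eventually.of_forall fun s => ?_) (Eventually.of_forall fun s => ?_) hε
    · simpa using hz.add_const l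
    · refine ((hk s).sub_const l).congr_deriv ?_
      have := hkpos s
      field_simp
      ring
    · have hprod : k s * l ≤ 1 / 4 := by
        calc k s * l ≤ 1 / 2 * (1 / 2) := mul_le_mul (hkm s).2 hl2 hl0.le (by norm_num)
          _ = 1 / 4 := by norm_num
      have hpp : 0 < k s * l := mul_pos (hkpos s) hl0
      have := logistic_pos ha s
      have hle : 2 * (a + logistic a s) ≤ (a + logistic a s) / (2 * (k s * l)) := by
        rw [le_div_iff₀ (by positivity)]
        nlinarith
      linarith
  have hV : ∀ η, HasDerivAt (fun η => logistic a (S η))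
      (logistic a (S η) * (-((a - logistic a (S η)) * k (S η)))) η := fun η =>
    ((hasDerivAt_logistic a (S η)).comp η (hS η)).congr_deriv (by ring)
  have hVbot : Tendsto (fun η => logistic a (S η)) atBot (𝓝 a) :=
    (tendsto_logistic_atBot ha).comp hSbot
  have hVtop : Tendsto (fun η => logistic a (S η)) atTop (𝓝 0) :=
    (tendsto_logistic_atTop ha).comp hStop
  refine ⟨fun η => logistic a (S η), fun η => -((a - logistic a (S η)) * k (S η)),
    ⟨fun η => ⟨hV η, ?_⟩, hVbot, ?_, hVtop, ?_, (strictAnti_logistic ha).comp_strictMono hSmono,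
    ⟨a, a * κ, by positivity, fun η hη => ?_⟩⟩⟩
  · have h := ((((hasDerivAt_const η a).sub (hV η)).mul ((hk (S η)).comp η (hS η)))).neg
    refine h.congr_deriv ?_
    have := (hkpos (S η)).ne'
    simp only [Pi.sub_apply, Function.comp]
    field_simp
    ring
  · refine squeeze_zero_norm (a := fun η => |a - logistic a (S η)| * (1 / 2)) (fun η => ?_) ?_
    · rw [Real.norm_eq_abs, abs_neg, abs_mul, abs_of_pos (hkpos _)]
      gcongr
      exact (hkm _).2
    · have := ((tendsto_const_nhds (x := a)).sub hVbot).abs.mul_const (1 / 2)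
      simpa using this
  · have := (((tendsto_const_nhds (x := a)).sub hVtop).mul (hklim.comp hStop)).neg
    rw [show -((a - 0) * (-wZero f a / a)) = wZero f a by field_simp; ring] at this
    exact this
  · rw [abs_of_pos (logistic_pos ha _)]
    refine (logistic_le_exp ha _).trans ?_
    gcongr
    have := mul_le_mul_of_nonneg_left (hSlow η hη) ha.le
    linarith

/-- Reflection exchanges the two kinds of orbits. -/
theorem isSharp_iff_isFlat {f V W : ℝ → ℝ} {a : ℝ} :
    IsSharp f a V W ↔ IsFlat (fun x => f (-x)) a (fun η => -V η) W := by
  have hw : wZero (fun x => f (-x)) a = wZero f a := by simp [wZero]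
  constructor
  · intro h
    refine ⟨fun η => ⟨(h.solves η).1.neg.congr_deriv (by ring),
      (h.solves η).2.congr_deriv (by simp)⟩, by simpa using h.V_atBot.neg, h.W_atBot,
      by simpa using h.V_atTop.neg, hw ▸ h.W_atTop, fun x y hxy => neg_lt_neg (h.mono hxy), ?_⟩
    obtain ⟨C, c, hc, hC⟩ := h.decay
    exact ⟨C, c, hc, by simpa using hC⟩
  · intro h
    refine ⟨fun η => ⟨by simpa [Pi.neg_def] using (h.solves η).1.neg,
      (h.solves η).2.congr_deriv (by simp)⟩, by simpa using h.V_atBot.neg, h.W_atBot,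
      by simpa using h.V_atTop.neg, hw ▸ h.W_atTop,
      fun x y hxy => neg_lt_neg_iff.1 (h.anti hxy), ?_⟩
    obtain ⟨C, c, hc, hC⟩ := h.decay
    exact ⟨C, c, hc, by simpa using hC⟩

theorem exists_isSharp {f : ℝ → ℝ} {a : ℝ} (hf : Continuous f) (ha : 0 < a)
    (hfa : ∀ x ∈ Icc (-a) 0, 2 * a ≤ f x) : ∃ V W : ℝ → ℝ, IsSharp f a V W := by
  obtain ⟨V, W, h⟩ := exists_isFlat (f := fun x => f (-x)) (hf.comp continuous_neg) ha
    fun x hx => hfa _ ⟨neg_le_neg hx.2, neg_nonpos.2 hx.1⟩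
  exact ⟨fun η => -V η, W, isSharp_iff_isFlat.2 (by simpa using h)⟩

/-! ### The change of variable Ξ and the glued profile -/

section Gluing

variable {f V W : ℝ → ℝ} {a : ℝ}

theorem IsFlat.pos (h : IsFlat f a V W) (η : ℝ) : 0 < V η :=
  (h.anti.antitone.le_of_tendsto h.V_atTop (η + 1)).trans_lt (h.anti (lt_add_one η))

theorem IsFlat.lt (h : IsFlat f a V W) (η : ℝ) : V η < a :=
  (h.anti (sub_one_lt η)).trans_le (h.anti.antitone.ge_of_tendsto h.V_atBot (η - 1))

theorem IsFlat.continuous (h : IsFlat f a V W) : Continuous V :=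
  continuous_iff_continuousAt.2 fun η => (h.solves η).1.continuousAt

theorem IsFlat.integrableOn (h : IsFlat f a V W) (η : ℝ) :
    MeasureTheory.IntegrableOn V (Ioi η) := by
  obtain ⟨C, c, hc, hC⟩ := h.decay
  refine integrable_of_isBigO_exp_neg hc h.continuous.continuousOn ?_
  refine Asymptotics.IsBigO.of_bound C ?_
  filter_upwards [eventually_ge_atTop 0] with η hη
  rw [Real.norm_eq_abs, Real.norm_eq_abs, Real.abs_exp]
  exact hC η hη

theorem IsFlat.xi_eq (h : IsFlat f a V W) (η : ℝ) :
    Xi V η = Xi V 0 + ∫ ζ in (0 : ℝ)..η, V ζ := by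
  have := intervalIntegral.integral_interval_add_Ioi (h.integrableOn 0) (h.integrableOn η)
  simp only [Xi]
  linarith

theorem IsFlat.hasDerivAt_xi (h : IsFlat f a V W) (η : ℝ) : HasDerivAt (Xi V) (V η) η := by
  have := (intervalIntegral.integral_hasDerivAt_right (h.continuous.intervalIntegrable 0 η)
    (h.continuous.stronglyMeasurableAtFilter _ _) h.continuous.continuousAt).const_add (Xi V 0)
  exact this.congr_of_eventuallyEq (Eventually.of_forall h.xi_eq)

theorem IsFlat.strictMono_xi (h : IsFlat f a V W) : StrictMono (Xi V) :=
  strictMono_of_deriv_pos fun η => by rw [(h.hasDerivAt_xi η).deriv]; exact h.pos η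

theorem IsFlat.tendsto_xi_atTop (h : IsFlat f a V W) : Tendsto (Xi V) atTop (𝓝 0) := by
  have h1 := (MeasureTheory.intervalIntegral_tendsto_integral_Ioi 0 (h.integrableOn 0)
    tendsto_id).const_add (Xi V 0)
  have h2 : Xi V 0 + ∫ ζ in Ioi 0, V ζ = 0 := by simp [Xi]
  rw [h2] at h1
  exact h1.congr fun η => (h.xi_eq η).symm

/-- V decreases, so Ξ has slope at least V(0) > 0 on the negative half-line. -/
theorem IsFlat.tendsto_xi_atBot (h : IsFlat f a V W) : Tendsto (Xi V) atBot atBot := by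
  have hle : ∀ η ≤ 0, Xi V η ≤ Xi V 0 + V 0 * η := by
    intro η hη
    have := (convex_Iic (0 : ℝ)).mul_sub_le_image_sub_of_le_deriv (f := Xi V) (C := V 0)
      (fun x _ => (h.hasDerivAt_xi x).continuousAt.continuousWithinAt)
      (fun x _ => (h.hasDerivAt_xi x).differentiableAt.differentiableWithinAt)
      (fun x hx => by
        rw [(h.hasDerivAt_xi x).deriv]
        rw [interior_Iic] at hx
        exact (h.anti hx).le) η hη 0 self_mem_Iic hη
    linarith
  refine tendsto_atBot_mono' _ ((eventually_le_atBot 0).mono hle) ?_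
  exact tendsto_atBot_add_const_left _ _ (tendsto_id.const_mul_atBot (h.pos 0))

theorem IsFlat.xi_neg (h : IsFlat f a V W) (η : ℝ) : Xi V η < 0 :=
  (h.strictMono_xi (lt_add_one η)).trans_le
    (h.strictMono_xi.monotone.ge_of_tendsto h.tendsto_xi_atTop (η + 1))

theorem IsFlat.bijOn_xi (h : IsFlat f a V W) : BijOn (Xi V) univ (Iio 0) := by
  refine ⟨fun η _ => h.xi_neg η, h.strictMono_xi.injective.injOn, fun ξ (hξ : ξ < 0) => ?_⟩
  rw [image_univ]
  refine mem_range_of_exists_le_of_exists_ge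
    (continuous_iff_continuousAt.2 fun η => (h.hasDerivAt_xi η).continuousAt)
    (h.tendsto_xi_atBot.eventually_le_atBot ξ).exists
    (h.tendsto_xi_atTop.eventually_const_le hξ).exists

theorem IsFlat.xi_invFun (h : IsFlat f a V W) {ξ : ℝ} (hξ : ξ < 0) :
    Xi V (Function.invFun (Xi V) ξ) = ξ := by
  obtain ⟨η, -, hη⟩ := h.bijOn_xi.surjOn hξ
  exact Function.invFun_eq ⟨η, hη⟩

theorem IsFlat.invFun_xi (h : IsFlat f a V W) (η : ℝ) : Function.invFun (Xi V) (Xi V η) = η :=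
  Function.leftInverse_invFun h.strictMono_xi.injective η

theorem IsFlat.strictMonoOn_invFun (h : IsFlat f a V W) :
    StrictMonoOn (Function.invFun (Xi V)) (Iio 0) := by
  intro x hx y hy hxy
  rw [← h.strictMono_xi.lt_iff_lt, h.xi_invFun hx, h.xi_invFun hy]
  exact hxy

theorem IsFlat.hasDerivAt_invFun (h : IsFlat f a V W) {ξ : ℝ} (hξ : ξ < 0) :
    HasDerivAt (Function.invFun (Xi V)) (V (Function.invFun (Xi V) ξ))⁻¹ ξ := by
  refine HasDerivAt.of_local_left_inverse (f := Xi V) ?_ (h.hasDerivAt_xi _) (h.pos _).ne' ?_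
  · refine h.strictMonoOn_invFun.continuousAt_of_image_mem_nhds (Iio_mem_nhds hξ) ?_
    rw [show Function.invFun (Xi V) '' Iio 0 = univ from
      eq_univ_of_forall fun η => ⟨Xi V η, h.xi_neg η, h.invFun_xi η⟩]
    exact univ_mem
  · filter_upwards [Iio_mem_nhds hξ] with x hx using h.xi_invFun hx

theorem IsFlat.tendsto_invFun_atBot (h : IsFlat f a V W) :
    Tendsto (Function.invFun (Xi V)) atBot atBot := by
  refine tendsto_atBot.2 fun N => ?_
  filter_upwards [eventually_le_atBot (Xi V N)] with ξ hξ
  rw [← h.strictMono_xi.le_iff_le, h.xi_invFun (hξ.trans_lt (h.xi_neg N))]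
  exact hξ

theorem IsFlat.tendsto_invFun_zero (h : IsFlat f a V W) :
    Tendsto (Function.invFun (Xi V)) (𝓝[<] 0) atTop := by
  refine tendsto_atTop.2 fun N => ?_
  filter_upwards [self_mem_nhdsWithin,
    mem_nhdsWithin_of_mem_nhds (Ioi_mem_nhds (h.xi_neg N))] with ξ hξ hN
  rw [← h.strictMono_xi.le_iff_le, h.xi_invFun hξ]
  exact le_of_lt hN

theorem Xi_neg (V : ℝ → ℝ) (η : ℝ) : Xi (fun η => -V η) η = -Xi V η := by
  simp [Xi, MeasureTheory.integral_neg]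

theorem IsSharp.bijOn_xi (h : IsSharp f a V W) : BijOn (Xi V) univ (Ioi 0) := by
  have h' := isSharp_iff_isFlat.1 h
  refine ⟨fun η _ => ?_, fun x _ y _ hxy => ?_, fun ξ (hξ : 0 < ξ) => ?_⟩
  · have := h'.xi_neg η
    rw [Xi_neg] at this
    exact neg_lt_zero.1 this
  · apply h'.strictMono_xi.injective
    rw [Xi_neg, Xi_neg, hxy]
  · obtain ⟨η, -, hη⟩ := h'.bijOn_xi.surjOn (show -ξ ∈ Iio 0 from neg_lt_zero.2 hξ)
    refine ⟨η, mem_univ _, ?_⟩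
    rw [Xi_neg] at hη
    exact neg_inj.1 hη

theorem IsSharp.invFun_eq (h : IsSharp f a V W) {ξ : ℝ} (hξ : 0 < ξ) :
    Function.invFun (Xi V) ξ = Function.invFun (Xi fun η => -V η) (-ξ) := by
  have h' := isSharp_iff_isFlat.1 h
  obtain ⟨η, -, rfl⟩ := h.bijOn_xi.surjOn hξ
  rw [Function.leftInverse_invFun (injOn_univ.1 h.bijOn_xi.injOn) η, ← Xi_neg, h'.invFun_xi]

theorem IsSharp.hasDerivAt_invFun (h : IsSharp f a V W) {ξ : ℝ} (hξ : 0 < ξ) :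
    HasDerivAt (Function.invFun (Xi V)) (V (Function.invFun (Xi V) ξ))⁻¹ ξ := by
  have h' := isSharp_iff_isFlat.1 h
  have hd := (h'.hasDerivAt_invFun (neg_lt_zero.2 hξ)).comp ξ (hasDerivAt_neg ξ)
  have hev : Function.invFun (Xi V) =ᶠ[𝓝 ξ]
      (Function.invFun (Xi fun η => -V η)) ∘ Neg.neg := by
    filter_upwards [Ioi_mem_nhds hξ] with x hx using h.invFun_eq hx
  refine (hd.congr_of_eventuallyEq hev).congr_deriv ?_
  rw [h.invFun_eq hξ, inv_neg]
  ring

theorem IsSharp.tendsto_invFun_atTop (h : IsSharp f a V W) :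
    Tendsto (Function.invFun (Xi V)) atTop atBot := by
  have h' := isSharp_iff_isFlat.1 h
  refine (h'.tendsto_invFun_atBot.comp tendsto_neg_atTop_atBot).congr' ?_
  filter_upwards [eventually_gt_atTop 0] with ξ hξ using (h.invFun_eq hξ).symm

theorem IsSharp.tendsto_invFun_zero (h : IsSharp f a V W) :
    Tendsto (Function.invFun (Xi V)) (𝓝[>] 0) atTop := by
  have h' := isSharp_iff_isFlat.1 h
  have hneg : Tendsto (fun x : ℝ => -x) (𝓝[>] 0) (𝓝[<] 0) := by
    simpa using tendsto_neg_nhdsGT (a := (0 : ℝ))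
  refine (h'.tendsto_invFun_zero.comp hneg).congr' ?_
  filter_upwards [self_mem_nhdsWithin] with ξ hξ using (h.invFun_eq hξ).symm

theorem IsSharp.neg (h : IsSharp f a V W) (η : ℝ) : V η < 0 :=
  neg_pos.1 ((isSharp_iff_isFlat.1 h).pos η)

theorem IsSharp.lt (h : IsSharp f a V W) (η : ℝ) : -a < V η :=
  neg_lt.1 ((isSharp_iff_isFlat.1 h).lt η)

/-- The change of variable `dη = dξ / V` turns the regular system into the singular one. -/
theorem SolvesReg.hasDerivAt_reparam (hs : SolvesReg f a V W) {Y : ℝ → ℝ} {ξ : ℝ}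
    (hY : HasDerivAt Y (V (Y ξ))⁻¹ ξ) (hne : V (Y ξ) ≠ 0) :
    HasDerivAt (fun x => V (Y x)) (W (Y ξ)) ξ ∧
    HasDerivAt (fun x => W (Y x)) ((-W (Y ξ) ^ 2 - f (V (Y ξ)) * W (Y ξ)
      + (V (Y ξ) ^ 2 - a ^ 2) / 2) / V (Y ξ)) ξ := by
  constructor
  · refine ((hs (Y ξ)).1.comp ξ hY).congr_deriv ?_
    field_simp
  · exact (hs (Y ξ)).2.comp ξ hY

section Glue

variable {V₁ V₂ G₁ G₂ : ℝ → ℝ} {z ξ : ℝ}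

theorem glue_of_neg (h : ξ < 0) :
    glue V₁ V₂ G₁ G₂ z ξ = G₁ (Function.invFun (Xi V₁) ξ) := if_pos h

theorem glue_of_pos (h : 0 < ξ) :
    glue V₁ V₂ G₁ G₂ z ξ = G₂ (Function.invFun (Xi V₂) ξ) := by
  rw [glue, if_neg h.not_gt, if_pos h]

theorem glue_zero : glue V₁ V₂ G₁ G₂ z 0 = z := by simp [glue]

theorem glue_eventuallyEq_of_neg (h : ξ < 0) : glue V₁ V₂ G₁ G₂ z =ᶠ[𝓝 ξ]
    fun x => G₁ (Function.invFun (Xi V₁) x) :=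
  eventually_of_mem (Iio_mem_nhds h) fun _ hx => glue_of_neg hx

theorem glue_eventuallyEq_of_pos (h : 0 < ξ) : glue V₁ V₂ G₁ G₂ z =ᶠ[𝓝 ξ]
    fun x => G₂ (Function.invFun (Xi V₂) x) :=
  eventually_of_mem (Ioi_mem_nhds h) fun _ hx => glue_of_pos hx

end Glue

variable {Vf Wf Vs Ws : ℝ → ℝ}

theorem continuousAt_glue_zero (hF : IsFlat f a Vf Wf) (hS : IsSharp f a Vs Ws)
    {G₁ G₂ : ℝ → ℝ} {z : ℝ} (h₁ : Tendsto G₁ atTop (𝓝 z)) (h₂ : Tendsto G₂ atTop (𝓝 z)) :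
    ContinuousAt (glue Vf Vs G₁ G₂ z) 0 := by
  rw [← continuousWithinAt_compl_self, ContinuousWithinAt, glue_zero, ← Iio_union_Ioi,
    nhdsWithin_union, tendsto_sup]
  constructor
  · refine (h₁.comp hF.tendsto_invFun_zero).congr' ?_
    filter_upwards [self_mem_nhdsWithin] with x hx using (glue_of_neg hx).symm
  · refine (h₂.comp hS.tendsto_invFun_zero).congr' ?_
    filter_upwards [self_mem_nhdsWithin] with x hx using (glue_of_pos hx).symm

theorem tendsto_glue_atBot (hF : IsFlat f a Vf Wf) {G₁ G₂ : ℝ → ℝ} {z l : ℝ}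
    (h₁ : Tendsto G₁ atBot (𝓝 l)) : Tendsto (glue Vf Vs G₁ G₂ z) atBot (𝓝 l) := by
  refine (h₁.comp hF.tendsto_invFun_atBot).congr' ?_
  filter_upwards [eventually_lt_atBot 0] with x hx using (glue_of_neg hx).symm

theorem tendsto_glue_atTop (hS : IsSharp f a Vs Ws) {G₁ G₂ : ℝ → ℝ} {z l : ℝ}
    (h₂ : Tendsto G₂ atBot (𝓝 l)) : Tendsto (glue Vf Vs G₁ G₂ z) atTop (𝓝 l) := by
  refine (h₂.comp hS.tendsto_invFun_atTop).congr' ?_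
  filter_upwards [eventually_gt_atTop 0] with x hx using (glue_of_pos hx).symm

theorem glue_ne_zero (hF : IsFlat f a Vf Wf) (hS : IsSharp f a Vs Ws) {x : ℝ} (hx : x ≠ 0) :
    glue Vf Vs Vf Vs 0 x ≠ 0 := by
  rcases hx.lt_or_gt with h | h
  · rw [glue_of_neg h]; exact (hF.pos _).ne'
  · rw [glue_of_pos h]; exact (hS.neg _).ne

theorem glue_mem_Ioo (ha : 0 < a) (hF : IsFlat f a Vf Wf) (hS : IsSharp f a Vs Ws) (x : ℝ) :
    glue Vf Vs Vf Vs 0 x ∈ Ioo (-a) a := by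
  rcases lt_trichotomy x 0 with h | rfl | h
  · rw [glue_of_neg h]
    exact ⟨by linarith [hF.pos (Function.invFun (Xi Vf) x)], hF.lt _⟩
  · rw [glue_zero]; exact ⟨by linarith, ha⟩
  · rw [glue_of_pos h]
    exact ⟨hS.lt _, by linarith [hS.neg (Function.invFun (Xi Vs) x)]⟩

theorem hasDerivAt_glue (hF : IsFlat f a Vf Wf) (hS : IsSharp f a Vs Ws) {v w : ℝ → ℝ} {z : ℝ}
    (hv : v = glue Vf Vs Vf Vs 0) (hw : w = glue Vf Vs Wf Ws z) {x : ℝ} (hx : x ≠ 0) :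
    HasDerivAt v (w x) x ∧
    HasDerivAt w ((-w x ^ 2 - f (v x) * w x + (v x ^ 2 - a ^ 2) / 2) / v x) x := by
  subst hv hw
  rcases hx.lt_or_gt with h | h
  · have hr := hF.solves.hasDerivAt_reparam (hF.hasDerivAt_invFun h) (hF.pos _).ne'
    rw [glue_of_neg h, glue_of_neg h]
    exact ⟨hr.1.congr_of_eventuallyEq (glue_eventuallyEq_of_neg h),
      hr.2.congr_of_eventuallyEq (glue_eventuallyEq_of_neg h)⟩
  · have hr := hS.solves.hasDerivAt_reparam (hS.hasDerivAt_invFun h) (hS.neg _).ne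
    rw [glue_of_pos h, glue_of_pos h]
    exact ⟨hr.1.congr_of_eventuallyEq (glue_eventuallyEq_of_pos h),
      hr.2.congr_of_eventuallyEq (glue_eventuallyEq_of_pos h)⟩

/-- Only ξ = 0 needs care: v is continuous there and its derivative w extends continuously, both
orbits having the limit w₀. -/
theorem hasDerivAt_glue_fst (hF : IsFlat f a Vf Wf) (hS : IsSharp f a Vs Ws) {v w : ℝ → ℝ}
    (hv : v = glue Vf Vs Vf Vs 0) (hw : w = glue Vf Vs Wf Ws (wZero f a)) (x : ℝ) :
    HasDerivAt v (w x) x := by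
  refine hasDerivAt_of_hasDerivAt_of_ne' (x := 0)
    (fun x hx => (hasDerivAt_glue hF hS hv hw hx).1) ?_ ?_ x
  · exact hv ▸ continuousAt_glue_zero hF hS hF.V_atTop hS.V_atTop
  · exact hw ▸ continuousAt_glue_zero hF hS hF.W_atTop hS.W_atTop

/-- The glued functions form a profile as soon as the second one is differentiable. -/
theorem isProfile_glue (ha : 0 < a) (hdisc : 0 ≤ f 0 ^ 2 - 2 * a ^ 2) (hF : IsFlat f a Vf Wf)
    (hS : IsSharp f a Vs Ws) {v w : ℝ → ℝ} (hv : v = glue Vf Vs Vf Vs 0)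
    (hw : w = glue Vf Vs Wf Ws (wZero f a)) (hwd : Differentiable ℝ w) : IsProfile f a v w where
  hasDeriv_v := hasDerivAt_glue_fst hF hS hv hw
  differentiable_w := hwd
  eq_w ξ := by
    by_cases hξ : ξ = 0
    · subst hξ
      rw [hv, hw, glue_zero, glue_zero]
      linear_combination wZero_quadratic hdisc
    · rw [(hasDerivAt_glue hF hS hv hw hξ).2.deriv]
      have : v ξ ≠ 0 := hv ▸ glue_ne_zero hF hS hξ
      field_simp
  v_atBot := hv ▸ tendsto_glue_atBot hF hF.V_atBot
  w_atBot := hw ▸ tendsto_glue_atBot hF hF.W_atBot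
  v_atTop := hv ▸ tendsto_glue_atTop hS hS.V_atBot
  w_atTop := hw ▸ tendsto_glue_atTop hS hS.W_atBot
  mem ξ := hv ▸ glue_mem_Ioo ha hF hS ξ

end Gluing

/-! ### Taylor coefficients and expansion at the sonic point -/

open Polynomial in
theorem iteratedDeriv_eval (F : ℝ[X]) (i : ℕ) :
    iteratedDeriv i (fun x => F.eval x) = fun x => ((derivative^[i]) F).eval x := by
  induction i with
  | zero => simp
  | succ i ih =>
    rw [iteratedDeriv_succ, ih, Function.iterate_succ_apply']
    funext x
    exact Polynomial.deriv _

open Polynomial in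
theorem iteratedDeriv_eval_zero_div (F : ℝ[X]) (i : ℕ) :
    iteratedDeriv i (fun x => F.eval x) 0 / (i.factorial : ℝ) = F.coeff i := by
  rw [iteratedDeriv_eval]
  beta_reduce
  rw [← coeff_zero_eq_eval_zero, coeff_iterate_derivative, zero_add,
    Nat.descFactorial_self, nsmul_eq_mul]
  field_simp

/-- Taylor coefficients at the sonic point, for a friction function with coefficients `c`. -/
noncomputable def taylorCoeff (c : ℕ → ℝ) (w₀ : ℝ) : ℕ → ℝ
  | 0 => w₀
  | k + 1 => (-(∑ i : Fin (k + 1), c (i + 1) * taylorCoeff c w₀ (k - i))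
      - (∑ i : Fin k, ((i : ℝ) + 2) * taylorCoeff c w₀ (i + 1) * taylorCoeff c w₀ (k - i))
      + if k = 1 then 1 / 2 else 0) / (c 0 + ((k : ℝ) + 3) * w₀)

/-- Right-hand sides of the recursion for `taylorCoeff`. -/
noncomputable def taylorRhs (c : ℕ → ℝ) (w₀ : ℝ) (k : ℕ) : ℝ :=
  -(∑ i ∈ Finset.range (k + 1), c (i + 1) * taylorCoeff c w₀ (k - i))
    - (∑ i ∈ Finset.range k, ((i : ℝ) + 2) * taylorCoeff c w₀ (i + 1) * taylorCoeff c w₀ (k - i))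
    + if k = 1 then 1 / 2 else 0

theorem taylorCoeff_zero (c : ℕ → ℝ) (w₀ : ℝ) : taylorCoeff c w₀ 0 = w₀ := by
  rw [taylorCoeff]

theorem taylorCoeff_succ (c : ℕ → ℝ) (w₀ : ℝ) (k : ℕ) :
    taylorCoeff c w₀ (k + 1) = taylorRhs c w₀ k / (c 0 + ((k : ℝ) + 3) * w₀) := by
  rw [taylorCoeff, taylorRhs, Finset.sum_range, Finset.sum_range]

theorem sum_Icc_one_eq_sum_range (g : ℕ → ℝ) (k : ℕ) :
    ∑ i ∈ Finset.Icc 1 k, g i = ∑ i ∈ Finset.range k, g (i + 1) := by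
  rw [Finset.range_eq_Ico, Finset.sum_Ico_add' g 0 k 1]
  rfl

-- One recursion covers all b_k: the term V²/2 contributes the extra 1/2 at k = 1 only. As w₀ < 0,
-- every denominator is at least f(0) + (n + 3) w₀ > 0.
open Polynomial in
theorem isCoeffs_taylorCoeff {F : ℝ[X]} {f : ℝ → ℝ} (hF : f = fun x => F.eval x) {a : ℝ} {n : ℕ}
    (hw : wZero f a < 0) (hn : 0 < f 0 + (n + 3) * wZero f a) :
    IsCoeffs f a n (taylorCoeff F.coeff (wZero f a)) (taylorRhs F.coeff (wZero f a)) := by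
  have hcoeff : ∀ i, iteratedDeriv i f 0 / (i.factorial : ℝ) = F.coeff i := fun i => by
    rw [hF]; exact iteratedDeriv_eval_zero_div F i
  have hf0 : f 0 = F.coeff 0 := by simpa using hcoeff 0
  have hf1 : deriv f 0 = F.coeff 1 := by simpa using hcoeff 1
  have hf2 : iteratedDeriv 2 f 0 / 2 = F.coeff 2 := by simpa using hcoeff 2
  set w₀ := wZero f a with hw₀
  have h0 := taylorCoeff_zero F.coeff w₀
  refine ⟨h0, fun k hk => ?_, fun k hk => ?_, ?_, fun _ => ?_, fun k hk => ?_⟩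
  · rw [h0]
    have : (k : ℝ) ≤ n + 1 := by exact_mod_cast (Finset.mem_Icc.1 hk).2
    nlinarith
  · obtain ⟨k, rfl⟩ : ∃ l, k = l + 1 := ⟨k - 1, by have := (Finset.mem_Icc.1 hk).1; omega⟩
    rw [taylorCoeff_succ, h0, hf0, Nat.add_sub_cancel]
    push_cast
    congr 1
    ring
  · simp [taylorRhs, h0, hf1]
  · rw [hf2, hf1]
    simp [taylorRhs, Finset.sum_range_succ, h0]
    ring
  · have hk1 : k ≠ 1 := by have := (Finset.mem_Icc.1 hk).1; omega
    rw [taylorRhs, if_neg hk1, add_zero, sum_Icc_one_eq_sum_range, sum_Icc_one_eq_sum_range]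
    congr 1
    · congr 1
      refine Finset.sum_congr rfl fun i _ => ?_
      rw [hcoeff, Nat.add_sub_add_right]
    · refine Finset.sum_congr rfl fun i _ => ?_
      rw [Nat.add_sub_add_right]
      push_cast
      ring

open Polynomial in
/-- The truncated formal series solves the equation of the orbits up to high order. -/
theorem X_pow_dvd_defect (F : ℝ[X]) {a w₀ : ℝ} (n : ℕ)
    (hquad : w₀ ^ 2 + F.coeff 0 * w₀ + a ^ 2 / 2 = 0)
    (hne : ∀ k ≤ n, F.coeff 0 + ((k : ℝ) + 3) * w₀ ≠ 0) (p : ℝ[X])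
    (hp : ∀ k ≤ n + 1, p.coeff k = taylorCoeff F.coeff w₀ k) :
    X ^ (n + 2) ∣ (X * derivative p + p) * p + F * p - C (1 / 2) * X ^ 2 + C (a ^ 2 / 2) := by
  -- Inserting w = p(v), w' = p'(v) w in the singular equation gives (X p' + p) p + F p - X²/2 +
  -- a²/2 = 0, and X p' + p multiplies the k-th coefficient by k + 1.
  have hq : ∀ k ≤ n + 1, (X * derivative p + p).coeff k
      = ((k : ℝ) + 1) * taylorCoeff F.coeff w₀ k := by
    intro k hk
    cases k with
    | zero => simp [hp 0 (by omega)]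
    | succ k =>
      rw [coeff_add, coeff_X_mul, coeff_derivative, hp _ hk]
      push_cast
      ring
  rw [X_pow_dvd_iff]
  intro k hk
  rw [coeff_add, coeff_sub, coeff_add, coeff_mul, coeff_mul, coeff_C_mul_X_pow,
    Finset.Nat.sum_antidiagonal_eq_sum_range_succ
      (fun i j : ℕ => ((X * derivative p + p : ℝ[X]).coeff i * p.coeff j : ℝ)),
    Finset.Nat.sum_antidiagonal_eq_sum_range_succ (fun i j : ℕ => (F.coeff i * p.coeff j : ℝ))]
  have e1 : ∑ i ∈ Finset.range k.succ, (X * derivative p + p).coeff i * p.coeff (k - i)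
      = ∑ i ∈ Finset.range k.succ,
        ((i : ℝ) + 1) * taylorCoeff F.coeff w₀ i * taylorCoeff F.coeff w₀ (k - i) := by
    refine Finset.sum_congr rfl fun i hi => ?_
    have := Finset.mem_range.1 hi
    rw [hq i (by omega), hp (k - i) (by omega)]
  have e2 : ∑ i ∈ Finset.range k.succ, F.coeff i * p.coeff (k - i)
      = ∑ i ∈ Finset.range k.succ, F.coeff i * taylorCoeff F.coeff w₀ (k - i) := by
    refine Finset.sum_congr rfl fun i hi => ?_
    rw [hp (k - i) (by omega)]
  rw [e1, e2]
  cases k with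
  | zero =>
    simp [taylorCoeff_zero]
    linarith
  | succ k =>
    have hs := taylorCoeff_succ F.coeff w₀ k
    rw [eq_div_iff (hne k (by omega)), taylorRhs] at hs
    -- The new coefficient w_{k+1} occurs only in the end terms split off here, with total factor w₀
    -- + (k + 2) w₀ + c₀: the denominator of the recursion.
    rw [Nat.succ_eq_add_one, Finset.sum_range_succ, Finset.sum_range_succ' _ k,
      Finset.sum_range_succ' _ (k + 1), coeff_C, if_neg (Nat.succ_ne_zero k)]
    simp only [Nat.add_sub_add_right, Nat.sub_zero, Nat.sub_self, taylorCoeff_zero]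
    have e3 : ∑ i ∈ Finset.range k, (((i + 1 : ℕ) : ℝ) + 1) * taylorCoeff F.coeff w₀ (i + 1)
          * taylorCoeff F.coeff w₀ (k - i)
        = ∑ i ∈ Finset.range k, ((i : ℝ) + 2) * taylorCoeff F.coeff w₀ (i + 1)
          * taylorCoeff F.coeff w₀ (k - i) := by
      refine Finset.sum_congr rfl fun i _ => ?_
      push_cast
      ring
    have e4 : (if k + 1 = 2 then (1 / 2 : ℝ) else 0) = if k = 1 then 1 / 2 else 0 := by
      simp
    rw [e3, e4]
    push_cast
    linear_combination hs

open Polynomial in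
/-- Asymptotic expansion of `w` in powers of `v` at the sonic point. -/
theorem isLittleO_expansion {F : ℝ[X]} {f v w : ℝ → ℝ} {a : ℝ} (hF : f = fun x => F.eval x)
    (hv0 : v 0 = 0) (hvne : ∀ x ≠ 0, v x ≠ 0) (hv : ∀ x, HasDerivAt v (w x) x)
    (hw : ∀ x ≠ 0, HasDerivAt w ((-w x ^ 2 - f (v x) * w x + (v x ^ 2 - a ^ 2) / 2) / v x) x)
    (hwc : ContinuousAt w 0) (hw0 : w 0 < 0) (hquad : w 0 ^ 2 + f 0 * w 0 + a ^ 2 / 2 = 0)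
    (n : ℕ) (hn : 0 < f 0 + (n + 3) * w 0) :
    (fun ξ => w ξ - ∑ k ∈ Finset.range (n + 2), taylorCoeff F.coeff (w 0) k * v ξ ^ k)
      =o[𝓝 0] (fun ξ => v ξ ^ (n + 1)) := by
  have hf0 : f 0 = F.coeff 0 := by rw [hF, coeff_zero_eq_eval_zero]
  let p : ℝ[X] := ∑ k ∈ Finset.range (n + 2), C (taylorCoeff F.coeff (w 0) k) * X ^ k
  have hp : ∀ k ≤ n + 1, p.coeff k = taylorCoeff F.coeff (w 0) k := by
    intro k hk
    simp only [p, finsetSum_coeff, coeff_C_mul_X_pow]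
    rw [Finset.sum_ite_eq, if_pos (Finset.mem_range.2 (by omega))]
  have hpe : ∀ x, p.eval x = ∑ k ∈ Finset.range (n + 2), taylorCoeff F.coeff (w 0) k * x ^ k := by
    intro x
    simp [p, eval_finsetSum]
  have hp0 : p.eval 0 = w 0 := by
    rw [← coeff_zero_eq_eval_zero, hp 0 (by omega), taylorCoeff_zero]
  obtain ⟨Q, hQ⟩ := X_pow_dvd_defect F (a := a) (w₀ := w 0) n (hf0 ▸ hquad)
    (fun k hk => by
      have : (k : ℝ) ≤ n := by exact_mod_cast hk
      rw [← hf0]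
      nlinarith) p hp
  have hE : ∀ x, (x * (derivative p).eval x + p.eval x) * p.eval x + f x * p.eval x
      - 1 / 2 * x ^ 2 + a ^ 2 / 2 = x ^ (n + 2) * Q.eval x := by
    intro x
    have := congrArg (Polynomial.eval x) hQ
    simpa [hF] using this
  -- Subtracting the equation satisfied by p up to X^{n+2} Q, the normalised remainder y solves v y'
  -- = α y + β. Here β(0) = 0 and α(0) = -(f(0) + (n + 3) w(0)) has the sign of w(0), so y tends to
  -- 0.
  let α : ℝ → ℝ := fun x => -(w x + p.eval (v x) + f (v x) + v x * (derivative p).eval (v x)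
    + (n + 1) * w x)
  let β : ℝ → ℝ := fun x => -(v x * Q.eval (v x))
  let y : ℝ → ℝ := fun x => (w x - p.eval (v x)) / v x ^ (n + 1)
  have hvc : ContinuousAt v 0 := (hv 0).continuousAt
  have hcomp : ∀ q : ℝ[X], ContinuousAt (fun x => q.eval (v x)) 0 := fun q =>
    q.continuous.continuousAt.comp hvc
  have hα : ContinuousAt α 0 := by
    have hfc : ContinuousAt (fun x => f (v x)) 0 := by rw [hF]; exact hcomp F
    exact ((((hwc.add (hcomp p)).add hfc).add (hvc.mul (hcomp _))).add
      (continuousAt_const.mul hwc)).neg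
  have hβ : ContinuousAt β 0 := (hvc.mul (hcomp Q)).neg
  have hα0 : α 0 = -(f 0 + (n + 3) * w 0) := by
    simp only [α, hv0, hp0]
    ring
  have hβ0 : β 0 = 0 := by simp [β, hv0]
  have hy : ∀ x ≠ 0, HasDerivAt y ((α x * y x + β x) / v x) x := by
    intro x hx
    have hne := hvne x hx
    have hpv : HasDerivAt (fun x => p.eval (v x)) ((derivative p).eval (v x) * w x) x :=
      (p.hasDerivAt (v x)).comp x (hv x)
    refine (((hw x hx).sub hpv).div ((hv x).pow (n + 1)) (pow_ne_zero _ hne)).congr_deriv ?_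
    have hEx := hE (v x)
    have hQx : Q.eval (v x) = ((v x * (derivative p).eval (v x) + p.eval (v x)) * p.eval (v x)
        + f (v x) * p.eval (v x) - 1 / 2 * v x ^ 2 + a ^ 2 / 2) / v x ^ (n + 2) := by
      rw [hEx]; field_simp
    simp only [α, β, y, hQx, Pi.sub_apply, Pi.pow_apply, Nat.add_sub_cancel]
    push_cast
    field_simp
    ring
  have hlim := tendsto_of_singular (hv 0) hv0 hw0.ne
    (eventually_mem_nhdsWithin.mono fun x hx => hy x hx)
    hα.continuousWithinAt hβ.continuousWithinAt (by
      rw [hα0]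
      exact div_pos_of_neg_of_neg (by linarith) hw0)
  -- Division by zero gives y(0) = 0, which is also the limit of y.
  have hy0 : y 0 = 0 := by simp [y, hv0]
  have hyc : Tendsto y (𝓝 0) (𝓝 0) := by
    have : ContinuousAt y 0 := by
      rw [← continuousWithinAt_compl_self, ContinuousWithinAt, hy0]
      simpa [hβ0] using hlim
    rw [ContinuousAt, hy0] at this
    exact this
  rw [Asymptotics.isLittleO_iff_tendsto]
  · simpa only [y, hpe] using hyc
  · intro x hx
    have hx0 : x = 0 := by
      by_contra h
      exact pow_ne_zero _ (hvne x h) hx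
    rw [hx0, ← hpe, hv0, hp0, sub_self]

open Polynomial in
theorem exists_polynomial_fPoly (γ R j c : ℝ) : ∃ F : ℝ[X], fPoly γ R j c = fun x => F.eval x :=
  ⟨C (4 * (γ - 1) / (j * R ^ 4 * (γ + 1))) * (C (c / (γ + 1)) - X) ^ 3 *
    (X + C (γ * c / (γ + 1))) ^ 3 * (C 2 * X + C ((γ - 1) * c / (γ + 1))), by
    funext x
    simp [fPoly]⟩

/-! ### Weak shocks and a uniform lower bound on f -/

/-- Rankine-Hugoniot: the strength of a `1`-shock in terms of the left state and its speed. -/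
theorem IsOneShock.strength_eq {γ σ : ℝ} {sm sp : GasState} (h : IsOneShock γ sm sp σ)
    (hγ : 1 < γ) (hsm : sm.Admissible) (hpos : 0 < strength sm sp) :
    (γ + 1) * (sm.u - σ) * strength sm sp = (sm.u - σ) ^ 2 - γ * (γ - 1) * sm.e := by
  obtain ⟨hρ, he⟩ := hsm
  have hc0 : 0 < γ * (γ - 1) * sm.e := by
    have : 0 < γ - 1 := by linarith
    positivity
  have hc : Real.sqrt (γ * (γ - 1) * sm.e) < sm.u - σ := by
    have := h.lax_left
    rw [GasState.sound] at this
    linarith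
  have hx : 0 < sm.u - σ := (Real.sqrt_nonneg _).trans_lt hc
  have hxc : γ * (γ - 1) * sm.e < (sm.u - σ) ^ 2 := (Real.sqrt_lt' hx).1 hc
  have hy : 0 < sp.u - σ := by linarith [h.lax_right_upper]
  have h1 := h.mass
  have h2 := h.momentum
  have h3 := h.energy
  simp only [massFlux, momentumFlux, energyFlux, GasState.pressure] at h1 h2 h3
  rw [strength, show sp.u - sm.u = (sp.u - σ) - (sm.u - σ) by ring] at hpos ⊢
  generalize sp.u - σ = y at *
  generalize sm.u - σ = x at *
  have hne : y - x ≠ 0 := by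
    intro h0
    rw [h0] at hpos
    simp at hpos
  -- Bernoulli's law
  have hb : γ * sp.e + y ^ 2 / 2 = γ * sm.e + x ^ 2 / 2 := by
    have hj : sm.ρ * x ≠ 0 := by positivity
    refine mul_left_cancel₀ hj ?_
    linear_combination h3 - (γ * sp.e + y ^ 2 / 2) * h1
  have hm : (x ^ 2 + (γ - 1) * sm.e) * y = (y ^ 2 + (γ - 1) * sp.e) * x := by
    refine mul_left_cancel₀ hρ.ne' ?_
    linear_combination (-y) * h2 + (y ^ 2 + (γ - 1) * sp.e) * h1
  -- Eliminating the right energy between Bernoulli's law and the momentum balance leaves the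
  -- trivial factor y - x times a Prandtl relation, affine in y.
  have hf : (y - x) * (γ * x * y - γ * (γ - 1) * sm.e - (γ - 1) * x * (x + y) / 2) = 0 := by
    linear_combination (-γ) * hm - (γ - 1) * x * hb
  have hf' := (mul_eq_zero.1 hf).resolve_left hne
  -- The Lax inequality x > c makes the shock compressive, which fixes the sign in the absolute
  -- value.
  have hlt : y - x < 0 := by
    have h5 : (γ + 1) * x * (y - x) = 2 * (γ * (γ - 1) * sm.e - x ^ 2) := by
      linear_combination 2 * hf'
    have h6 : 0 < (γ + 1) * x := by positivity
    by_contra hcon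
    have := mul_nonneg h6.le (not_lt.1 hcon)
    linarith
  rw [abs_of_neg hlt]
  linear_combination -hf'

/-- With x = u₋ - σ and c the sound speed, x² - c² = (γ + 1) x a ≤ c x, which is impossible if x >
2c. This bounds j from above, and f carries the factor 1/j. -/
theorem IsOneShock.velocity_le {γ σ : ℝ} {sm sp : GasState} (h : IsOneShock γ sm sp σ)
    (hγ : 1 < γ) (hsm : sm.Admissible) (hpos : 0 < strength sm sp)
    (hle : strength sm sp ≤ sm.sound γ / (γ + 1)) : sm.u - σ ≤ 2 * sm.sound γ := by
  have hs := h.strength_eq hγ hsm hpos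
  have hc := h.lax_left
  have hsq : sm.sound γ ^ 2 = γ * (γ - 1) * sm.e := by
    have : 0 ≤ γ - 1 := by linarith
    have := hsm.2
    exact Real.sq_sqrt (by positivity)
  have hc0 : 0 ≤ sm.sound γ := Real.sqrt_nonneg _
  rw [le_div_iff₀ (by linarith)] at hle
  rw [← hsq] at hs
  by_contra! hcon
  have h1 : (γ + 1) * (sm.u - σ) * strength sm sp ≤ (sm.u - σ) * sm.sound γ := by
    calc (γ + 1) * (sm.u - σ) * strength sm sp = (sm.u - σ) * (strength sm sp * (γ + 1)) := by ring
      _ ≤ _ := mul_le_mul_of_nonneg_left hle (by linarith)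
  nlinarith

theorem sound_pos {γ : ℝ} (hγ : 1 < γ) {s : GasState} (hs : s.Admissible) : 0 < s.sound γ := by
  have : 0 < γ - 1 := by linarith
  have := hs.2
  exact Real.sqrt_pos.2 (by positivity)

/-- C₁ = v + P/j is at least v, which exceeds the sound speed by the Lax inequality. The bound does
not depend on σ. -/
theorem sound_le_C₁ {γ σ : ℝ} (hγ : 1 < γ) {s : GasState} (hs : s.Admissible)
    (h : σ < s.u - s.sound γ) : s.sound γ ≤ C₁ γ σ s := by
  have hc := sound_pos hγ hs
  have hx : 0 < s.u - σ := by linarith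
  obtain ⟨hρ, he⟩ := hs
  rw [C₁, massFlux, le_div_iff₀ (mul_pos hρ hx), momentumFlux, GasState.pressure]
  have h1 : s.sound γ * (s.ρ * (s.u - σ)) ≤ s.ρ * (s.u - σ) ^ 2 := by
    calc s.sound γ * (s.ρ * (s.u - σ)) ≤ (s.u - σ) * (s.ρ * (s.u - σ)) := by
          gcongr
          linarith
      _ = _ := by ring
  have h2 : 0 ≤ (γ - 1) * s.ρ * s.e := by
    have : 0 < γ - 1 := by linarith
    positivity
  linarith

/-- At x = 0 the three affine factors are at least s/(γ + 1), s/(γ + 1) and (γ - 1)s/(γ + 1). The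
two bounds on |x| are such that each factor keeps at least half of these values. -/
theorem fPoly_ge {γ R j c J s x : ℝ} (hγ : 1 < γ) (hR : 0 < R) (hj : 0 < j) (hjJ : j ≤ J)
    (hs : 0 < s) (hsc : s ≤ c) (hx₁ : |x| ≤ s / (2 * (γ + 1)))
    (hx₂ : |x| ≤ (γ - 1) * s / (4 * (γ + 1))) :
    4 * (γ - 1) / (J * R ^ 4 * (γ + 1)) * (s / (2 * (γ + 1))) ^ 3 * (s / (2 * (γ + 1))) ^ 3 *
      ((γ - 1) * s / (2 * (γ + 1))) ≤ fPoly γ R j c x := by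
  have hγ0 : 0 < γ - 1 := by linarith
  have hγ1 : 0 < γ + 1 := by linarith
  have hJ : 0 < J := hj.trans_le hjJ
  obtain ⟨l1, u1⟩ := abs_le.1 hx₁
  obtain ⟨l2, u2⟩ := abs_le.1 hx₂
  have hc : s / (γ + 1) ≤ c / (γ + 1) := by gcongr
  have e1 : s / (γ + 1) = 2 * (s / (2 * (γ + 1))) := by field_simp
  have b1 : s / (2 * (γ + 1)) ≤ c / (γ + 1) - x := by linarith
  have b2 : s / (2 * (γ + 1)) ≤ x + γ * c / (γ + 1) := by
    have : s / (γ + 1) ≤ γ * c / (γ + 1) := by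
      gcongr
      nlinarith
    linarith
  have b3 : (γ - 1) * s / (2 * (γ + 1)) ≤ 2 * x + (γ - 1) * c / (γ + 1) := by
    have h1 : (γ - 1) * s / (γ + 1) ≤ (γ - 1) * c / (γ + 1) := by gcongr
    have h2 : (γ - 1) * s / (γ + 1) = 4 * ((γ - 1) * s / (4 * (γ + 1))) := by field_simp
    have h3 : (γ - 1) * s / (2 * (γ + 1)) = 2 * ((γ - 1) * s / (4 * (γ + 1))) := by
      field_simp; norm_num
    linarith
  have p1 : 0 < s / (2 * (γ + 1)) := by positivity
  have q1 : 0 < c / (γ + 1) - x := p1.trans_le b1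
  have q2 : 0 < x + γ * c / (γ + 1) := p1.trans_le b2
  unfold fPoly
  gcongr

/-- Along the shocks of small strength, `f` is bounded below uniformly near the origin. -/
theorem exists_uniform_lower_bound {γ R : ℝ} (hγ : 1 < γ) (hR : 0 < R) {sm : GasState}
    (hsm : sm.Admissible) :
    ∃ δ > 0, ∃ m > 0, ∀ (sp : GasState) (σ : ℝ), IsOneShock γ sm sp σ → 0 < strength sm sp →
      strength sm sp ≤ δ → ∀ x, |x| ≤ δ → m ≤ shockF γ R σ sm x := by
  have hs := sound_pos hγ hsm
  have hγ0 : 0 < γ - 1 := by linarith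
  have hρ := hsm.1
  set s := sm.sound γ with hsdef
  have d1 : 0 < s / (2 * (γ + 1)) := by positivity
  have d2 : 0 < (γ - 1) * s / (4 * (γ + 1)) := by positivity
  refine ⟨min (s / (2 * (γ + 1))) ((γ - 1) * s / (4 * (γ + 1))), lt_min d1 d2,
    4 * (γ - 1) / (sm.ρ * (2 * s) * R ^ 4 * (γ + 1)) * (s / (2 * (γ + 1))) ^ 3 *
      (s / (2 * (γ + 1))) ^ 3 * ((γ - 1) * s / (2 * (γ + 1))), by positivity,
    fun sp σ h hpos hle x hx => ?_⟩
  have hle' : strength sm sp ≤ s / (γ + 1) :=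
    (hle.trans (min_le_left _ _)).trans (by gcongr; linarith)
  have hv := h.velocity_le hγ hsm hpos hle'
  have hl := h.lax_left
  exact fPoly_ge hγ hR (mul_pos hρ (by linarith)) (mul_le_mul_of_nonneg_left hv hρ.le) hs
    (sound_le_C₁ hγ hsm hl) (hx.trans (min_le_left _ _)) (hx.trans (min_le_right _ _))

end RadShock

/-! ### Choice of the thresholds and conclusion -/

theorem theorem3p2 (γ R : ℝ) (hγ : 1 < γ)
    (hγ' : γ < (Real.sqrt 7 + 1) / (Real.sqrt 7 - 1)) (hR : 0 < R)
    (sm : GasState) (hsm : sm.Admissible) :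
    ∃ A : ℕ → ℝ, Antitone A ∧ (∀ n, 0 < A n) ∧
      ∀ (n : ℕ) (sp : GasState) (σ : ℝ), sp.Admissible → IsOneShock γ sm sp σ →
        ∀ (a : ℝ) (f : ℝ → ℝ), a = strength sm sp → f = shockF γ R σ sm → a ∈ Ioc 0 (A n) →
          -- the number `w₀` and the two orbits exist
          0 < f 0 ^ 2 - 2 * a ^ 2 ∧ wZero f a < 0 ∧
          (∃ V W : ℝ → ℝ, IsFlat f a V W) ∧ (∃ V W : ℝ → ℝ, IsSharp f a V W) ∧
          ∃ wc bc : ℕ → ℝ, IsCoeffs f a n wc bc ∧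
            ∀ Vf Wf Vs Ws : ℝ → ℝ, IsFlat f a Vf Wf → IsSharp f a Vs Ws →
              -- the changes of variable used in the gluing are bijections
              BijOn (Xi Vf) univ (Iio 0) ∧ BijOn (Xi Vs) univ (Ioi 0) ∧
              ∀ v w : ℝ → ℝ, v = glue Vf Vs Vf Vs 0 → w = glue Vf Vs Wf Ws (wZero f a) →
                IsProfile f a v w ∧
                ContDiff ℝ ((n + 1 : ℕ) : WithTop ℕ∞) w ∧
                ContDiff ℝ ((n + 2 : ℕ) : WithTop ℕ∞) v ∧
                (fun ξ => w ξ - ∑ k ∈ Finset.range (n + 2), wc k * v ξ ^ k)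
                  =o[𝓝 0] (fun ξ => v ξ ^ (n + 1)) := by
  obtain ⟨δ, hδ, m, hm, hbound⟩ := exists_uniform_lower_bound hγ hR hsm
  -- The second bound gives (n + 3) a ≤ m ≤ f(0), whence f(0) + (n + 3) w₀ ≥ (n + 3) a / 2 > 0. It
  -- also gives 2a ≤ m, needed for the orbits. Neither δ nor m depends on n, σ or the right state.
  refine ⟨fun n => min δ (m / (n + 3)), fun n n' hnn' => ?_, fun n => ?_, ?_⟩
  · have : (n : ℝ) ≤ n' := by exact_mod_cast hnn'
    simp only
    gcongr
  · exact lt_min hδ (by positivity)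
  intro n sp σ _ hshock a f ha hf hmem
  obtain ⟨ha0, haA⟩ := hmem
  have haδ : a ≤ δ := haA.trans (min_le_left _ _)
  have ham : (n + 3) * a ≤ m := by
    have := haA.trans (min_le_right _ _)
    rw [le_div_iff₀ (by positivity)] at this
    linarith
  have hfm : ∀ x, |x| ≤ a → m ≤ f x := fun x hx => by
    rw [hf]
    exact hbound sp σ hshock (ha ▸ ha0) (ha ▸ haδ) x (hx.trans haδ)
  have hn0 : (0 : ℝ) ≤ n := n.cast_nonneg
  have h2a : 2 * a ≤ m := by nlinarith
  have hfa : ∀ x, |x| ≤ a → 2 * a ≤ f x := fun x hx => h2a.trans (hfm x hx)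
  have hf0 : (n + 3) * a ≤ f 0 := ham.trans (hfm 0 (by simpa using ha0.le))
  have hf0' : 2 * a ≤ f 0 := hfa 0 (by simpa using ha0.le)
  obtain ⟨F, hF⟩ := exists_polynomial_fPoly γ R (massFlux σ sm) (C₁ γ σ sm)
  have hfF : f = fun x => F.eval x := hf.trans hF
  have hsmooth : ContDiff ℝ (⊤ : ℕ∞) f := by
    rw [hfF]
    simpa using F.contDiff_aeval (𝕜 := ℝ) (⊤ : ℕ∞)
  have hdisc := disc_pos ha0 hf0'
  have hw0 := wZero_neg ha0 hf0'
  have hn : 0 < f 0 + (n + 3) * wZero f a := by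
    have := mul_le_mul_of_nonneg_left (neg_half_le_wZero ha0 hf0') (by positivity : (0 : ℝ) ≤ n + 3)
    nlinarith
  refine ⟨hdisc, hw0,
    exists_isFlat hsmooth.continuous ha0 fun x hx => hfa x (abs_le.2 ⟨by linarith [hx.1], hx.2⟩),
    exists_isSharp hsmooth.continuous ha0 fun x hx => hfa x (abs_le.2 ⟨hx.1, by linarith [hx.2]⟩),
    _, _, isCoeffs_taylorCoeff hfF hw0 hn, ?_⟩
  intro Vf Wf Vs Ws hFl hSh
  refine ⟨hFl.bijOn_xi, hSh.bijOn_xi, fun v w hv hw => ?_⟩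
  have hv0 : v 0 = 0 := by rw [hv, glue_zero]
  have hwz : w 0 = wZero f a := by rw [hw, glue_zero]
  have hvne : ∀ x ≠ 0, v x ≠ 0 := fun x hx => hv ▸ glue_ne_zero hFl hSh hx
  have hvd := hasDerivAt_glue_fst hFl hSh hv hw
  have hwd : ∀ x ≠ 0, HasDerivAt w
      ((-w x ^ 2 - f (v x) * w x + (v x ^ 2 - a ^ 2) / 2) / v x) x :=
    fun x hx => (hasDerivAt_glue hFl hSh hv hw hx).2
  have hwc : ContinuousAt w 0 := hw ▸ continuousAt_glue_zero hFl hSh hFl.W_atTop hSh.W_atTop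
  have hwC := contDiff_of_singular_system hsmooth hv0 hvne hvd hwd hwc (hwz ▸ hw0) n (hwz ▸ hn)
  refine ⟨isProfile_glue ha0 hdisc.le hFl hSh hv hw (hwC.differentiable (by simp)), hwC, ?_, ?_⟩
  · rw [show ((n + 2 : ℕ) : WithTop ℕ∞) = ((n + 1 : ℕ) : WithTop ℕ∞) + 1 by push_cast; rfl,
      contDiff_succ_iff_deriv]
    refine ⟨fun x => (hvd x).differentiableAt, by simp, ?_⟩
    rwa [show deriv v = w from funext fun x => (hvd x).deriv]
  · have := isLittleO_expansion hfF hv0 hvne hvd hwd hwc (hwz ▸ hw0)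
      (hwz ▸ wZero_quadratic hdisc.le) n (hwz ▸ hn)
    rwa [hwz] at this
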